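/- Let $d\ge 3$ and let $\mathcal G_{N,d}$ be the uniform random simple $d$-regular graph on $\{1,\dots,N\}$; "a.a.s." means with probability tending to $1$ as $N\to\infty$ with $Nd$ even. An independent set $A$ of a graph is called $\hat d$-thin if every vertex outside $A$ has at most $\hat d$ neighbours in $A$. Let $k>d/2$ and $1\le\hat d<\min(d,k)$ be integers, and put $$\alpha_{d,k}=1-\frac{d}{2k},\qquad \tau_+=\frac{\hat d+1}{d}.$$ With $h(x)=-x\log x$, $h(0)=0$, define for $\alpha\in[0,1/2]$, $\beta\in[0,1-2\alpha]$, $\tau\in[0,1]$ with $\tau\beta\le\alpha$ $$\hat\varphi_d(\alpha,\beta,\tau)=\frac d2\Big(2h(\beta)+2\beta\big(h(\tau)+h(1-\tau)\big)+2h(\alpha-\tau\beta)+2h\big(1-2\alpha-(1-\tau)\beta\big)-h(1-2\alpha)\Big)-(d-1)\big(h(\alpha)+h(\beta)+h(1-\alpha-\beta)\big),$$ and $$\beta_{\max}=\inf\{\beta>0:\hat\varphi_d(\alpha,\beta,\tau_+)<0\}\qquad(\inf\emptyset=+\infty),$$ where $\beta$ and $\tau$ always range over the domain of $\hat\varphi_d(\alpha,\cdot,\cdot)$.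 Suppose that $\mathcal G_{N,d}$ a.a.s. contains an independent set of density $\alpha$ (that is, of size $(\alpha+o(1))N$), and that $\hat d+1\ge \frac{d\alpha}{1-\alpha}$ (the right-hand side is the average number of neighbours in such a set of a vertex outside it). Suppose further that $(d-\hat d)\,\beta_{\max}<\alpha-\alpha_{d,k}$ or, more generally, that $$(\tau d-\hat d)\,\beta<\alpha-\alpha_{d,k}\quad\text{for all }\beta\le\beta_{\max}\text{ and }\tau\ge\tau_+\text{ with }\hat\varphi_d(\alpha,\beta,\tau)\ge 0 .$$ Then $\mathcal G_{N,d}$ a.a.s. contains a $\hat d$-thin independent set of density $\alpha_{d,k}$, that is, of size exactly $\lceil\alpha_{d,k}N\rceil$ (which is $\alpha_{d,k}N$ whenever $2k\mid Nd$). -/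

import Mathlib

open Filter Topology

noncomputable section

namespace ThinSets

/-- The set of simple `d`-regular graphs on the labelled vertex set `Fin N`. -/
def regularGraphs (N d : ℕ) : Set (SimpleGraph (Fin N)) :=
  open Classical in {G | G.IsRegularOfDegree d}

/-- The probability that the uniform random simple `d`-regular graph on `N` labelled vertices
has the property `P` (the number of favourable graphs over the number of all graphs). -/
def regularProb (N d : ℕ) (P : SimpleGraph (Fin N) → Prop) : ℝ :=
  ({G ∈ regularGraphs N d | P G}.ncard : ℝ) / ((regularGraphs N d).ncard : ℝ)

/-- The random `d`-regular graph a.a.s. has the property `P`: the probability tends to `1` as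
`N → ∞` along those `N` for which `N * d` is even (there is no `d`-regular graph for other `N`). -/
def AAS (d : ℕ) (P : (N : ℕ) → SimpleGraph (Fin N) → Prop) : Prop :=
  Tendsto (fun N => regularProb N d (P N)) (atTop ⊓ 𝓟 {N : ℕ | Even (N * d)}) (𝓝 1)

/-- The random `d`-regular graph a.a.s. contains an independent set of density `α`
(that is, `α + o(1)`; `α * N` need not be an integer). -/
def AASIndepDensity (d : ℕ) (α : ℝ) : Prop :=
  ∀ ε : ℝ, 0 < ε → AAS d fun N G =>
    ∃ A : Finset (Fin N), G.IsIndepSet (A : Set (Fin N)) ∧ |(A.card : ℝ) / (N : ℝ) - α| < ε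

/-- `A` is an `m`-thin independent set of `G`: it is independent, and every vertex outside `A`
has at most `m` neighbours in `A`. -/
def IsThin {V : Type*} (G : SimpleGraph V) (m : ℕ) (A : Finset V) : Prop :=
  G.IsIndepSet (A : Set V) ∧ ∀ v ∉ A, (G.neighborSet v ∩ (A : Set V)).ncard ≤ m

/-- The density `α_{d,k} = 1 - d / (2 k)`. -/
def alphaDK (d k : ℕ) : ℝ := 1 - (d : ℝ) / (2 * (k : ℝ))

/-- The function `h(x) = - x log x` on `[0, 1]`, with `h(0) = 0`. -/
abbrev h (x : ℝ) : ℝ := Real.negMulLog x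

/-- The rate function `φ̂_d(α, β, τ)`. -/
def phiHat (d : ℕ) (α β τ : ℝ) : ℝ :=
  (d : ℝ) / 2 *
      (2 * h β + 2 * β * (h τ + h (1 - τ)) + 2 * h (α - τ * β)
        + 2 * h (1 - 2 * α - (1 - τ) * β) - h (1 - 2 * α))
    - ((d : ℝ) - 1) * (h α + h β + h (1 - α - β))

/-- The domain of `φ̂_d(α, ·, ·)`: `β ∈ [0, 1 - 2α]` and `τ ∈ [0, 1]`, with `τ β ≤ α`, as `h` is
evaluated at `α - τ β`. -/
def InDomain (α β τ : ℝ) : Prop :=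
  0 ≤ β ∧ β ≤ 1 - 2 * α ∧ 0 ≤ τ ∧ τ ≤ 1 ∧ τ * β ≤ α

/-- `τ₊ = (d̂ + 1) / d`. -/
def tauPlus (d dhat : ℕ) : ℝ := ((dhat : ℝ) + 1) / (d : ℝ)

/-- `β_max = inf {β > 0 : φ̂_d(α, β, τ₊) < 0}`, an extended real (`inf ∅ = +∞`). -/
def betaMax (d dhat : ℕ) (α : ℝ) : EReal :=
  sInf ((fun β : ℝ => (β : EReal)) ''
    {β : ℝ | 0 < β ∧ InDomain α β (tauPlus d dhat) ∧ phiHat d α β (tauPlus d dhat) < 0})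

/-- The condition `(d - d̂) β_max < α - α_{d,k}`. -/
def SimpleCondition (d k dhat : ℕ) (α : ℝ) : Prop :=
  (((d : ℝ) - (dhat : ℝ) : ℝ) : EReal) * betaMax d dhat α < ((α - alphaDK d k : ℝ) : EReal)

/-- The condition that `(τ d - d̂) β < α - α_{d,k}` for any `β ≤ β_max` and `τ ≥ τ₊` with
`φ̂_d(α, β, τ) ≥ 0`. -/
def BestCondition (d k dhat : ℕ) (α : ℝ) : Prop :=
  ∀ β τ : ℝ, InDomain α β τ → (β : EReal) ≤ betaMax d dhat α → tauPlus d dhat ≤ τ →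
    0 ≤ phiHat d α β τ → (τ * (d : ℝ) - (dhat : ℝ)) * β < α - alphaDK d k

end ThinSets

end

/-! Take an independent set `A` of density about `α`, and let `B` be the set of outside vertices
with more than `dhat` neighbours in `A`. Deleting the excess neighbours of each vertex of `B` makes
`A` thin (`exists_isThin`). If `B` has density `β` and a fraction `τ ≥ τ₊` of its half-edges goes to
`A`, this lowers the density of `A` by at most `(τ d - dhat) β`. It remains to see that a.a.s. only
cheap pairs `(β, τ)` occur.

The first moment method supplies this: the expected number of pairs `(A, B)` with parameters `(α, β,
τ)` is `exp(N phiHat)` up to polynomial factors, so a.a.s. every pair has rate at least `-δ`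
(`aas_rateBound`). The numerator of the expectation is bounded by pairings of half-edges
(`ncard_typedGraphs_mul_le`, `ncard_typedPairings_mul_le`). The denominator, the number of regular
graphs, is bounded below by inserting two vertices at a time (`card_regSet_mul_pow_le`). Stirling's
formula turns the quotient into the rate function (`rate_identity`).

The rate condition alone does not exclude values `β > β_max` at which the rate is nonnegative again.
But every subset of `B` also sends at least the fraction `τ₊` of its half-edges to `A`. Some `s`, at
or just above `β_max`, has negative rate at `τ₊`, hence at all `τ ≥ τ₊` by monotonicity
(`phiHat_le_of_le`). If `β` exceeded `s`, a subset of `B` of density about `s` would violate the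
first moment bound. Compactness makes all of this uniform near `α` (`exists_repair_margin`), and
`exists_isThin_card_eq` assembles the pieces. -/

namespace ThinSets

/-! ### Regular graphs on arbitrary vertex types -/

/-- The `d`-regular graphs on `V`, with degrees measured by `Set.ncard`. -/
def regSet (V : Type*) (d : ℕ) : Set (SimpleGraph V) :=
  {G | ∀ v, (G.neighborSet v).ncard = d}

lemma regularGraphs_eq_regSet (N d : ℕ) : regularGraphs N d = regSet (Fin N) d := by
  classical
  ext G
  simp only [regularGraphs, regSet, Set.mem_ofPred_eq, SimpleGraph.IsRegularOfDegree]
  refine forall_congr' fun v => ?_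
  rw [← SimpleGraph.card_neighborSet_eq_degree, ← Nat.card_eq_fintype_card, Nat.card_coe_set_eq]

lemma comap_mem_regSet {V W : Type*} (e : V ≃ W) {d : ℕ} {G : SimpleGraph W}
    (hG : G ∈ regSet W d) : G.comap e ∈ regSet V d := by
  intro v
  have : (G.comap e).neighborSet v = e ⁻¹' G.neighborSet (e v) := by
    ext u; simp
  rw [this, Set.ncard_preimage_of_injective_subset_range e.injective
    (by simp [e.surjective.range_eq])]
  exact hG _

lemma ncard_regSet_congr {V W : Type*} (e : V ≃ W) (d : ℕ) :
    (regSet V d).ncard = (regSet W d).ncard := by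
  refine Set.ncard_congr (fun G _ => G.comap e.symm) ?_ ?_ ?_
  · intro G hG
    exact comap_mem_regSet e.symm hG
  · intro G H _ _ h
    ext v w
    have := congrArg (fun K : SimpleGraph W => K.Adj (e v) (e w)) h
    simpa using this
  · intro G hG
    exact ⟨G.comap e, comap_mem_regSet e hG, by ext a b; simp⟩

/-! ### Adding two vertices to a regular graph -/

/-- Number of sequences from `D` without conflicts. -/
lemma pow_le_card_conflictFree {α : Type*} [Fintype α] (D : Finset α) (r : α → α → Prop) (K : ℕ)
    (hK : ∀ p ∈ D, {q ∈ (D : Set α) | r q p}.ncard ≤ K) (n : ℕ) :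
    (D.card - n * K) ^ n ≤
      {f : Fin n → α | (∀ i, f i ∈ D) ∧ ∀ i j, i < j → ¬ r (f i) (f j)}.ncard := by
  classical
  induction n with
  | zero =>
    simp only [pow_zero]
    refine (Set.ncard_pos (Set.toFinite _)).2 ?_
    exact ⟨Fin.elim0, fun i => i.elim0, fun i => i.elim0⟩
  | succ n ih =>
    set S : ∀ n, Finset (Fin n → α) := fun n => Finset.univ.filter
      fun f => (∀ i, f i ∈ D) ∧ ∀ i j, i < j → ¬ r (f i) (f j) with hS
    have hcard : ∀ n, {f : Fin n → α | (∀ i, f i ∈ D) ∧ ∀ i j, i < j → ¬ r (f i) (f j)}.ncard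
        = (S n).card := by
      intro n
      rw [← Set.ncard_coe_finset]; congr 1; ext; simp [hS]
    rw [hcard] at ih ⊢
    let T : (Fin n → α) → Finset α := fun f => D.filter fun p => ∀ j, ¬ r p (f j)
    have hT : ∀ f ∈ S n, D.card - n * K ≤ (T f).card := by
      intro f hf
      have hf' := (Finset.mem_filter.1 hf).2
      have hsub : D ⊆ T f ∪ Finset.univ.biUnion fun j => D.filter fun p => r p (f j) := by
        intro p hp
        by_cases h : ∀ j, ¬ r p (f j)
        · exact Finset.mem_union_left _ (Finset.mem_filter.2 ⟨hp, h⟩)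
        · push Not at h
          obtain ⟨j, hj⟩ := h
          exact Finset.mem_union_right _ (Finset.mem_biUnion.2
            ⟨j, Finset.mem_univ _, Finset.mem_filter.2 ⟨hp, hj⟩⟩)
      have h1 := Finset.card_le_card hsub
      have h2 := Finset.card_union_le (T f)
        (Finset.univ.biUnion fun j => D.filter fun p => r p (f j))
      have h3 : (Finset.univ.biUnion fun j => D.filter fun p => r p (f j)).card ≤ n * K := by
        refine (Finset.card_biUnion_le_card_mul _ _ K ?_).trans (by simp)
        intro j _
        have := hK (f j) (hf'.1 j)
        rw [← Set.ncard_coe_finset]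
        simpa using this
      omega
    have hle : ((S n).sigma T).card ≤ (S (n + 1)).card := by
      -- The new element goes to index `0`, so the added conditions with `i < j` are exactly those
      -- defining `T f`.
      refine Finset.card_le_card_of_injOn (fun x => Fin.cons x.2 x.1) ?_ ?_
      · rintro ⟨f, p⟩ hx
        simp only [Finset.coe_sigma, Set.mem_sigma_iff, Finset.mem_coe] at hx
        have hf := (Finset.mem_filter.1 hx.1).2
        have hp := Finset.mem_filter.1 hx.2
        refine Finset.mem_coe.2 (Finset.mem_filter.2 ⟨Finset.mem_univ _, ?_, ?_⟩)
        · intro i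
          refine Fin.cases ?_ (fun i => ?_) i
          · simpa using hp.1
          · simpa using hf.1 i
        · intro i j
          refine Fin.cases ?_ (fun i => ?_) i <;> refine Fin.cases ?_ (fun j => ?_) j
          · simp
          · intro _; simpa using hp.2 j
          · simp
          · intro h
            simpa using hf.2 i j (Fin.succ_lt_succ_iff.1 h)
      · rintro ⟨f, p⟩ _ ⟨g, q⟩ _ h
        obtain ⟨h1, h2⟩ := Fin.cons_inj.1 h
        subst h1; subst h2; rfl
    rw [Finset.card_sigma] at hle
    calc (D.card - (n + 1) * K) ^ (n + 1)
        ≤ (D.card - n * K) ^ (n + 1) := by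
          gcongr; omega
      _ = (D.card - n * K) ^ n * (D.card - n * K) := pow_succ _ _
      _ ≤ (S n).card * (D.card - n * K) := by gcongr
      _ ≤ ∑ f ∈ S n, (T f).card := by
          rw [← smul_eq_mul]; exact Finset.card_nsmul_le_sum _ _ _ hT
      _ ≤ _ := hle

/-- Two new vertices `inr false`, `inr true`; the edges `z false i - z true i` are removed and
replaced by edges from `z b i` to `inr b`. -/
def extendGraph {V : Type*} {d : ℕ} (G : SimpleGraph V) (z : Bool → Fin d → V) :
    SimpleGraph (V ⊕ Bool) where
  Adj p q := match p, q with
    | .inl v, .inl w => G.Adj v w ∧ ∀ b i, ¬ (z b i = v ∧ z (!b) i = w)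
    | .inl v, .inr b => ∃ i, z b i = v
    | .inr b, .inl v => ∃ i, z b i = v
    | .inr _, .inr _ => False
  symm := by
    constructor
    rintro (v | b) (w | c) h
    · exact ⟨h.1.symm, fun b i hb => h.2 (!b) i ⟨by simpa using hb.2, by simpa using hb.1⟩⟩
    · exact h
    · exact h
    · exact h
  loopless := by
    constructor
    rintro (v | b) h
    · exact G.loopless.irrefl _ h.1
    · exact h

/-- `z` lists pairwise disjoint edges of `G`. -/
def IsEdgeSeq {V : Type*} {d : ℕ} (G : SimpleGraph V) (z : Bool → Fin d → V) : Prop :=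
  (∀ i, G.Adj (z false i) (z true i)) ∧ ∀ b c i j, z b i = z c j → b = c ∧ i = j

lemma IsEdgeSeq.adj {V : Type*} {d : ℕ} {G : SimpleGraph V} {z : Bool → Fin d → V}
    (hz : IsEdgeSeq G z) (b : Bool) (i : Fin d) : G.Adj (z b i) (z (!b) i) := by
  cases b
  · exact hz.1 i
  · exact (hz.1 i).symm

lemma extendGraph_mem_regSet {V : Type*} [Finite V] {d : ℕ} {G : SimpleGraph V}
    (hG : G ∈ regSet V d) {z : Bool → Fin d → V} (hz : IsEdgeSeq G z) :
    extendGraph G z ∈ regSet (V ⊕ Bool) d := by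
  classical
  rintro (v | b)
  · by_cases h : ∃ b i, z b i = v
    · obtain ⟨b, i, rfl⟩ := h
      have : (extendGraph G z).neighborSet (.inl (z b i)) =
          insert (.inr b) (Sum.inl '' (G.neighborSet (z b i) \ {z (!b) i})) := by
        ext (w | c)
        · simp only [SimpleGraph.mem_neighborSet, Set.mem_insert_iff, Set.mem_image, Sum.inl.injEq,
            exists_eq_right, reduceCtorEq, false_or, Set.mem_sdiff, Set.mem_singleton_iff]
          constructor
          · rintro ⟨h1, h2⟩
            exact ⟨h1, fun h => h2 b i ⟨rfl, h.symm⟩⟩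
          · rintro ⟨h1, h2⟩
            refine ⟨h1, fun c j hc => h2 ?_⟩
            obtain ⟨rfl, rfl⟩ := hz.2 _ _ _ _ hc.1
            exact hc.2.symm
        · simp only [SimpleGraph.mem_neighborSet, Set.mem_insert_iff, Sum.inr.injEq, Set.mem_image,
            reduceCtorEq, and_false, exists_false, or_false]
          constructor
          · rintro ⟨j, hj⟩
            exact (hz.2 _ _ _ _ hj).1
          · rintro rfl
            exact ⟨i, rfl⟩
      rw [this, Set.ncard_insert_of_notMem (by simp),
        Set.ncard_image_of_injective _ Sum.inl_injective,
        Set.ncard_sdiff_singleton_add_one (show z (!b) i ∈ G.neighborSet (z b i) from hz.adj b i)]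
      exact hG _
    · have : (extendGraph G z).neighborSet (.inl v) = Sum.inl '' (G.neighborSet v) := by
        ext (w | c)
        · simp only [SimpleGraph.mem_neighborSet, Set.mem_image, Sum.inl.injEq, exists_eq_right]
          exact ⟨fun h => h.1, fun h1 => ⟨h1, fun c j hc => h ⟨c, j, hc.1⟩⟩⟩
        · simp only [SimpleGraph.mem_neighborSet, Set.mem_image, reduceCtorEq, and_false,
            exists_false, iff_false]
          rintro ⟨j, hj⟩
          exact h ⟨c, j, hj⟩
      rw [this, Set.ncard_image_of_injective _ Sum.inl_injective]
      exact hG _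
  · have : (extendGraph G z).neighborSet (.inr b) = Set.range fun i => Sum.inl (z b i) := by
      ext (w | c)
      · simp only [SimpleGraph.mem_neighborSet, Set.mem_range, Sum.inl.injEq]
        exact Iff.rfl
      · simp only [SimpleGraph.mem_neighborSet, Set.mem_range, reduceCtorEq, exists_false, iff_false]
        exact id
    rw [this, ← Set.image_univ, Set.ncard_image_of_injective]
    · simp
    · intro i j h
      exact (hz.2 _ _ _ _ (Sum.inl_injective h)).2

/-- Once `z` is known, the deleted edges are known too: they join `z false i` to `z true i`. -/
lemma extendGraph_injective {V : Type*} {d : ℕ} {G H : SimpleGraph V} {z : Bool → Fin d → V}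
    (hG : IsEdgeSeq G z) (hH : IsEdgeSeq H z) (h : extendGraph G z = extendGraph H z) : G = H := by
  have key : ∀ {G H : SimpleGraph V}, IsEdgeSeq G z → IsEdgeSeq H z →
      extendGraph G z = extendGraph H z → ∀ v w, G.Adj v w → H.Adj v w := by
    intro G H hG hH h v w hvw
    by_cases hb : ∃ b i, z b i = v ∧ z (!b) i = w
    · obtain ⟨b, i, rfl, rfl⟩ := hb
      exact hH.adj b i
    · have h1 : (extendGraph G z).Adj (.inl v) (.inl w) :=
        ⟨hvw, fun b i hc => hb ⟨b, i, hc⟩⟩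
      rw [h] at h1
      exact h1.1
  ext v w
  exact ⟨key hG hH h v w, key hH hG h.symm v w⟩

/-- Choose `d` oriented edges greedily. There are `d * |V|` oriented edges, and each meets at most
`4 * d` of them: four ways for two endpoints to coincide, with `d` oriented edges for each. -/
lemma pow_le_card_isEdgeSeq {V : Type*} [Fintype V] {d : ℕ} {G : SimpleGraph V}
    (hG : G ∈ regSet V d) :
    (d * Fintype.card V - d * (4 * d)) ^ d ≤ {z : Bool → Fin d → V | IsEdgeSeq G z}.ncard := by
  classical
  let D : Finset (V × V) := Finset.univ.filter fun p => G.Adj p.1 p.2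
  let r : V × V → V × V → Prop := fun p q => p.1 = q.1 ∨ p.1 = q.2 ∨ p.2 = q.1 ∨ p.2 = q.2
  have hD1 : ∀ v, {q ∈ (D : Set (V × V)) | q.1 = v}.ncard = d := by
    intro v
    have : {q ∈ (D : Set (V × V)) | q.1 = v} = (fun w => (v, w)) '' G.neighborSet v := by
      ext ⟨a, b⟩
      simp only [Finset.coe_filter, Finset.mem_univ, true_and, Set.mem_ofPred_eq, Set.mem_image,
        SimpleGraph.mem_neighborSet, Prod.mk.injEq, D]
      constructor
      · rintro ⟨h, rfl⟩; exact ⟨b, h, rfl, rfl⟩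
      · rintro ⟨w, h, rfl, rfl⟩; exact ⟨h, rfl⟩
    rw [this, Set.ncard_image_of_injective _ (Prod.mk_right_injective v)]
    exact hG v
  have hD2 : ∀ v, {q ∈ (D : Set (V × V)) | q.2 = v}.ncard = d := by
    intro v
    have : {q ∈ (D : Set (V × V)) | q.2 = v} = (fun w => (w, v)) '' G.neighborSet v := by
      ext ⟨a, b⟩
      simp only [Finset.coe_filter, Finset.mem_univ, true_and, Set.mem_ofPred_eq, Set.mem_image,
        SimpleGraph.mem_neighborSet, Prod.mk.injEq, D]
      constructor
      · rintro ⟨h, rfl⟩; exact ⟨a, h.symm, rfl, rfl⟩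
      · rintro ⟨w, h, rfl, rfl⟩; exact ⟨h.symm, rfl⟩
    rw [this, Set.ncard_image_of_injective _ (Prod.mk_left_injective v)]
    exact hG v
  have hDcard : D.card = d * Fintype.card V := by
    have h1 : ∀ v ∈ (Finset.univ : Finset V), (D.filter fun p => p.1 = v).card = d := by
      intro v _
      rw [← hD1 v, ← Set.ncard_coe_finset]; congr 1; ext; simp
    rw [Finset.card_eq_sum_card_fiberwise (f := Prod.fst) (t := Finset.univ) (by simp),
      Finset.sum_congr rfl h1]
    simp [mul_comm]
  have hK : ∀ p ∈ D, {q ∈ (D : Set (V × V)) | r q p}.ncard ≤ 4 * d := by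
    intro p _
    have : {q ∈ (D : Set (V × V)) | r q p} ⊆
        (({q ∈ (D : Set (V × V)) | q.1 = p.1} ∪ {q ∈ (D : Set (V × V)) | q.1 = p.2}) ∪
        ({q ∈ (D : Set (V × V)) | q.2 = p.1} ∪ {q ∈ (D : Set (V × V)) | q.2 = p.2})) := by
      rintro q ⟨hq, h | h | h | h⟩
      · exact .inl (.inl ⟨hq, h⟩)
      · exact .inl (.inr ⟨hq, h⟩)
      · exact .inr (.inl ⟨hq, h⟩)
      · exact .inr (.inr ⟨hq, h⟩)
    refine (Set.ncard_le_ncard this (Set.toFinite _)).trans ?_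
    refine (Set.ncard_union_le _ _).trans ?_
    have h1 := Set.ncard_union_le {q ∈ (D : Set (V × V)) | q.1 = p.1}
      {q ∈ (D : Set (V × V)) | q.1 = p.2}
    have h2 := Set.ncard_union_le {q ∈ (D : Set (V × V)) | q.2 = p.1}
      {q ∈ (D : Set (V × V)) | q.2 = p.2}
    rw [hD1, hD1] at h1
    rw [hD2, hD2] at h2
    omega
  have := pow_le_card_conflictFree D r (4 * d) hK d
  rw [hDcard] at this
  refine this.trans ?_
  refine Set.ncard_le_ncard_of_injOn
    (fun f b i => bif b then (f i).2 else (f i).1) ?_ ?_ (Set.toFinite _)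
  · rintro f ⟨hf1, hf2⟩
    have hadj : ∀ i, G.Adj (f i).1 (f i).2 := fun i => (Finset.mem_filter.1 (hf1 i)).2
    refine ⟨fun i => by simpa using hadj i, ?_⟩
    intro b c i j h
    have hij : i = j := by
      rcases lt_trichotomy i j with hij | hij | hij
      · exact absurd (by cases b <;> cases c <;> simp at h <;> simp [r, h]) (hf2 i j hij)
      · exact hij
      · exact absurd (by cases b <;> cases c <;> simp at h <;> simp [r, h]) (hf2 j i hij)
    subst hij
    refine ⟨?_, rfl⟩
    have := (hadj i).ne
    cases b <;> cases c <;> simp at h ⊢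
    · exact this h
    · exact this h.symm
  · intro f _ g _ h
    funext i
    have h1 := congrFun (congrFun h false) i
    have h2 := congrFun (congrFun h true) i
    simp at h1 h2
    exact Prod.ext h1 h2

/-- Double counting of the insertions `(G, z)`. The extended graph together with `z` determines `G`,
and for a given extended graph each `z b` enumerates the `d` neighbours of `inr b`, which leaves at
most `d!` choices for each of the two new vertices. -/
lemma card_regSet_mul_pow_le {V : Type*} [Fintype V] (d : ℕ) :
    (regSet V d).ncard * (d * Fintype.card V - d * (4 * d)) ^ d ≤
      (d.factorial * d.factorial) * (regSet (V ⊕ Bool) d).ncard := by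
  classical
  let R : Finset (SimpleGraph V) := Finset.univ.filter (· ∈ regSet V d)
  let R' : Finset (SimpleGraph (V ⊕ Bool)) := Finset.univ.filter (· ∈ regSet (V ⊕ Bool) d)
  have hR : (regSet V d).ncard = R.card := by
    rw [← Set.ncard_coe_finset]; congr 1; ext; simp [R]
  have hR' : (regSet (V ⊕ Bool) d).ncard = R'.card := by
    rw [← Set.ncard_coe_finset]; congr 1; ext; simp [R']
  let E : SimpleGraph V → Finset (Bool → Fin d → V) := fun G => Finset.univ.filter (IsEdgeSeq G)
  have hE : ∀ G ∈ R, (d * Fintype.card V - d * (4 * d)) ^ d ≤ (E G).card := by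
    intro G hG
    refine (pow_le_card_isEdgeSeq (Finset.mem_filter.1 hG).2).trans (le_of_eq ?_)
    rw [← Set.ncard_coe_finset]; congr 1; ext; simp [E]
  let T : Finset (SimpleGraph (V ⊕ Bool) × (Bool → Fin d → V)) := Finset.univ.filter fun x =>
    x.1 ∈ regSet (V ⊕ Bool) d ∧ ∀ b, Function.Injective (x.2 b) ∧ ∀ i, x.1.Adj (.inr b) (.inl (x.2 b i))
  have h1 : (R.sigma E).card ≤ T.card := by
    refine Finset.card_le_card_of_injOn (fun x => (extendGraph x.1 x.2, x.2)) ?_ ?_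
    · rintro ⟨G, z⟩ hx
      simp only [Finset.coe_sigma, Set.mem_sigma_iff, Finset.mem_coe] at hx
      have hz : IsEdgeSeq G z := (Finset.mem_filter.1 hx.2).2
      refine Finset.mem_coe.2 (Finset.mem_filter.2 ⟨Finset.mem_univ _,
        extendGraph_mem_regSet (Finset.mem_filter.1 hx.1).2 hz, fun b => ⟨?_, ?_⟩⟩)
      · intro i j h
        exact (hz.2 _ _ _ _ h).2
      · intro i
        exact ⟨i, rfl⟩
    · rintro ⟨G, z⟩ hx ⟨H, z'⟩ hy h
      simp only [Finset.coe_sigma, Set.mem_sigma_iff, Finset.mem_coe] at hx hy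
      obtain ⟨h1, h2⟩ := Prod.mk.inj h
      dsimp only at h1 h2
      subst h2
      have := extendGraph_injective (Finset.mem_filter.1 hx.2).2 (Finset.mem_filter.1 hy.2).2 h1
      subst this
      rfl
  have h2 : T.card ≤ (d.factorial * d.factorial) * R'.card := by
    refine Finset.card_le_mul_card_image_of_maps_to (f := Prod.fst) ?_ _ ?_
    · intro x hx
      exact Finset.mem_filter.2 ⟨Finset.mem_univ _, (Finset.mem_filter.1 hx).2.1⟩
    · intro G hG
      have hreg := (Finset.mem_filter.1 hG).2
      have hc : ∀ b, Fintype.card (Fin d ↪ G.neighborSet (.inr b)) = d.factorial := by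
        intro b
        have : Fintype.card (G.neighborSet (.inr b)) = d := by
          rw [← Nat.card_eq_fintype_card, Nat.card_coe_set_eq]; exact hreg _
        rw [Fintype.card_embedding_eq, this, Fintype.card_fin, Nat.descFactorial_self]
      have : Fintype.card (∀ b : Bool, (Fin d ↪ G.neighborSet (.inr b))) =
          d.factorial * d.factorial := by
        rw [Fintype.card_pi]
        simp [hc, sq]
      rw [← this, ← Fintype.card_coe]
      refine Fintype.card_le_of_injective (fun x b => ⟨fun i => ⟨.inl (x.1.2 b i), ?_⟩, ?_⟩) ?_
      · have hx := Finset.mem_filter.1 x.2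
        have h := ((Finset.mem_filter.1 hx.1).2.2 b).2 i
        rw [hx.2] at h
        exact h
      · have hx := Finset.mem_filter.1 x.2
        have h := ((Finset.mem_filter.1 hx.1).2.2 b).1
        intro i j hij
        exact h (Sum.inl_injective (congrArg Subtype.val hij))
      · rintro ⟨⟨G1, z1⟩, hx⟩ ⟨⟨G2, z2⟩, hy⟩ h
        have e1 := (Finset.mem_filter.1 hx).2
        have e2 := (Finset.mem_filter.1 hy).2
        dsimp only at e1 e2
        subst e1; subst e2
        have : z1 = z2 := by
          funext b i
          have := DFunLike.congr_fun (congrFun h b) i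
          exact Sum.inl_injective (congrArg Subtype.val this)
        subst this
        rfl
  rw [Finset.card_sigma] at h1
  rw [hR, hR', ← smul_eq_mul]
  exact (Finset.card_nsmul_le_sum _ _ _ hE).trans (h1.trans h2)

lemma card_regularGraphs_mul_pow_le (N d : ℕ) :
    (regularGraphs N d).ncard * (d * N - d * (4 * d)) ^ d ≤
      (d.factorial * d.factorial) * (regularGraphs (N + 2) d).ncard := by
  have h := card_regSet_mul_pow_le (V := Fin N) d
  rw [Fintype.card_fin] at h
  rw [regularGraphs_eq_regSet, regularGraphs_eq_regSet]
  have e : Fin N ⊕ Bool ≃ Fin (N + 2) :=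
    (Equiv.sumCongr (Equiv.refl _) finTwoEquiv.symm).trans finSumFinEquiv
  rwa [← ncard_regSet_congr e]

/-! ### Upper bounds by pairings of half-edges -/

/-- The perfect matchings of `X`, as fixed-point-free involutions. -/
def pairings (X : Type*) : Set (Equiv.Perm X) :=
  {σ | (∀ x, σ (σ x) = x) ∧ ∀ x, σ x ≠ x}

/-- A fixed-point-free involution of `2 * k` points has cycle type `2, ..., 2` with `k` entries, and
the size of this conjugacy class is known. -/
lemma ncard_pairings_mul_le {X : Type*} [Fintype X] {k : ℕ} (hk : Fintype.card X = 2 * k) :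
    (pairings X).ncard * (2 ^ k * k.factorial) ≤ (2 * k).factorial := by
  classical
  have hsub : pairings X ⊆
      ((Finset.univ.filter fun g : Equiv.Perm X => g.cycleType = Multiset.replicate k 2 :
        Finset (Equiv.Perm X)) : Set (Equiv.Perm X)) := by
    rintro σ ⟨h1, h2⟩
    have : Fact (Nat.Prime 2) := ⟨Nat.prime_two⟩
    have hσ : σ ^ 2 = 1 := by
      ext x; simp [sq, h1]
    have hc := Equiv.Perm.cycleType_of_pow_prime_eq_one hσ
    have hfix : (Function.fixedPoints σ) = ∅ := by
      ext x; simpa [Function.IsFixedPt] using h2 x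
    simp only [Finset.coe_filter, Finset.mem_univ, true_and, Set.mem_ofPred_eq]
    have hs : σ.support = Finset.univ := by
      ext x; simp [h2]
    have hsum := σ.sum_cycleType
    have hall : ∀ n ∈ σ.cycleType, n = 2 := by
      intro n hn
      rw [hc] at hn
      exact Multiset.eq_of_mem_replicate hn
    have hrep := Multiset.eq_replicate_card.2 hall
    rw [hrep] at hsum ⊢
    rw [hs, Finset.card_univ, hk, Multiset.sum_replicate, smul_eq_mul] at hsum
    rw [show σ.cycleType.card = k by omega]
  have h1 := Set.ncard_le_ncard hsub (Set.toFinite _)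
  rw [Set.ncard_coe_finset] at h1
  have h2 := Equiv.Perm.card_of_cycleType_mul_eq X (Multiset.replicate k 2)
  have h3 : (∏ n ∈ (Multiset.replicate k 2).toFinset,
      ((Multiset.replicate k 2).count n).factorial) = k.factorial := by
    rcases Nat.eq_zero_or_pos k with rfl | hk0
    · simp
    · rw [Multiset.toFinset_replicate, if_neg hk0.ne', Finset.prod_singleton,
        Multiset.count_replicate_self]
  rw [h3, Multiset.prod_replicate, Multiset.sum_replicate, smul_eq_mul, hk, mul_comm k 2,
    Nat.sub_self, Nat.factorial_zero, one_mul] at h2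
  calc _ ≤ _ := Nat.mul_le_mul_right _ h1
    _ = _ := h2
    _ ≤ _ := by split_ifs <;> simp

/-- The pairings in which the points of `P` are matched outside `P`, exactly `t` of them to `Q`. -/
def typedPairings {X : Type*} (P Q : Finset X) (t : ℕ) : Set (Equiv.Perm X) :=
  {σ ∈ pairings X | (∀ x ∈ P, σ x ∉ P) ∧ {x ∈ (P : Set X) | σ x ∈ Q}.ncard = t}

/-- With the partners of `P` prescribed and outside `P`, such a pairing is determined by its
restriction to the `2 * k` points outside `P` and `g(P)`. If nothing extends `g`, the bound is
trivial. -/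
lemma ncard_pairings_extending_le {X : Type*} [Fintype X] (P : Finset X) (g : X → X) {k : ℕ}
    (hk : Fintype.card X = 2 * P.card + 2 * k) :
    {σ ∈ pairings X | (∀ x ∈ P, σ x ∉ P) ∧ ∀ x ∈ P, σ x = g x}.ncard * (2 ^ k * k.factorial) ≤
      (2 * k).factorial := by
  classical
  rcases Set.eq_empty_or_nonempty
    {σ ∈ pairings X | (∀ x ∈ P, σ x ∉ P) ∧ ∀ x ∈ P, σ x = g x} with h0 | ⟨τ, hτ, hτP, hτg⟩
  · simp [h0]
  have hcard : Fintype.card {x // x ∉ P ∧ x ∉ P.image g} = 2 * k := by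
    have h1 : Fintype.card {x // x ∉ P ∧ x ∉ P.image g} = (P ∪ P.image g)ᶜ.card := by
      rw [Fintype.card_subtype]; congr 1; ext x
      simp only [Finset.mem_filter, Finset.mem_univ, true_and, Finset.mem_compl, Finset.mem_union]
      tauto
    have h2 : P.image g = P.image τ := Finset.image_congr fun x hx => (hτg x hx).symm
    have h3 : Disjoint P (P.image τ) := by
      rw [Finset.disjoint_left]
      intro x hx hx'
      obtain ⟨y, hy, rfl⟩ := Finset.mem_image.1 hx'
      exact hτP y hy hx
    rw [h1, h2, Finset.card_compl, Finset.card_union_of_disjoint h3,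
      Finset.card_image_of_injective _ τ.injective]
    omega
  refine le_trans (Nat.mul_le_mul_right _ ?_) (ncard_pairings_mul_le hcard)
  have hinv : ∀ σ ∈ {σ ∈ pairings X | (∀ x ∈ P, σ x ∉ P) ∧ ∀ x ∈ P, σ x = g x},
      ∀ x, (x ∉ P ∧ x ∉ P.image g) ↔ (σ x ∉ P ∧ σ x ∉ P.image g) := by
    rintro σ ⟨hσ, hσP, hσg⟩ x
    have h2 : P.image g = P.image σ := Finset.image_congr fun x hx => (hσg x hx).symm
    have h3 : ∀ x, x ∈ P.image σ ↔ σ x ∈ P := by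
      intro x
      rw [Finset.mem_image]
      constructor
      · rintro ⟨y, hy, rfl⟩; rwa [hσ.1]
      · intro h; exact ⟨_, h, hσ.1 x⟩
    rw [h2, h3, h3, hσ.1]
    tauto
  refine Set.ncard_le_ncard_of_injOn
    (fun σ => if h : ∀ x, (x ∉ P ∧ x ∉ P.image g) ↔ (σ x ∉ P ∧ σ x ∉ P.image g)
      then σ.subtypePerm (fun x => (h x).symm) else 1) ?_ ?_ (Set.toFinite _)
  · intro σ hσ
    rw [dif_pos (hinv σ hσ)]
    refine ⟨fun x => Subtype.ext ?_, fun x h => ?_⟩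
    · simpa using hσ.1.1 x
    · exact hσ.1.2 x (by simpa using congrArg Subtype.val h)
  · intro σ hσ ρ hρ h
    simp only at h
    rw [dif_pos (hinv σ hσ), dif_pos (hinv ρ hρ)] at h
    ext x
    by_cases hx : x ∈ P
    · rw [hσ.2.2 x hx, hρ.2.2 x hx]
    by_cases hx' : x ∈ P.image g
    · obtain ⟨y, hy, rfl⟩ := Finset.mem_image.1 hx'
      have h1 : σ (g y) = y := by rw [← hσ.2.2 y hy, hσ.1.1]
      have h2 : ρ (g y) = y := by rw [← hρ.2.2 y hy, hρ.1.1]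
      rw [h1, h2]
    · have := DFunLike.congr_fun h ⟨x, hx, hx'⟩
      simpa using congrArg Subtype.val this

/-- Choose the `t` points of `P` that are matched into `Q`, inject them into `Q`, inject the other
points of `P` into the complement of `P ∪ Q`, and pair what is left. -/
lemma ncard_typedPairings_mul_le {X : Type*} [Fintype X] [DecidableEq X] (P Q : Finset X) (t : ℕ)
    {k : ℕ} (hk : Fintype.card X = 2 * P.card + 2 * k) :
    (typedPairings P Q t).ncard * (2 ^ k * k.factorial) ≤
      (P.card.choose t * (Q.card.descFactorial t *
        ((P ∪ Q)ᶜ.card).descFactorial (P.card - t))) * (2 * k).factorial := by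
  classical
  let F : Finset (Equiv.Perm X) := Finset.univ.filter (· ∈ typedPairings P Q t)
  have hF : (typedPairings P Q t).ncard = F.card := by
    rw [← Set.ncard_coe_finset]; congr 1; ext; simp [F]
  set R := (P ∪ Q)ᶜ with hR
  -- The largest number of pairings that agree on `P`. Its bound is known only after multiplication
  -- by `2 ^ k * k!`, so working with the maximum avoids a division.
  set M := F.sup fun σ => {ρ ∈ pairings X | (∀ x ∈ P, ρ x ∉ P) ∧ ∀ x ∈ P, ρ x = σ x}.ncard with hM
  have hMle : M * (2 ^ k * k.factorial) ≤ (2 * k).factorial := by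
    rcases F.eq_empty_or_nonempty with h | h
    · simp [hM, h]
    · obtain ⟨σ, _, hσ⟩ := Finset.exists_mem_eq_sup F h
        fun σ => {ρ ∈ pairings X | (∀ x ∈ P, ρ x ∉ P) ∧ ∀ x ∈ P, ρ x = σ x}.ncard
      rw [hM, hσ]
      exact ncard_pairings_extending_le P σ hk
  -- The value off `P` is an arbitrary fixed choice, so that `res σ` records exactly the restriction
  -- of `σ` to `P`.
  let res : Equiv.Perm X → X → X := fun σ x => if x ∈ P then σ x else x
  let S : (X → X) → Finset X := fun f => P.filter fun x => f x ∈ Q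
  have h1 : F.card ≤ M * (F.image res).card := by
    refine Finset.card_le_mul_card_image _ _ ?_
    intro f hf
    obtain ⟨σ, hσ, rfl⟩ := Finset.mem_image.1 hf
    refine le_trans ?_ (Finset.le_sup (f := fun σ : Equiv.Perm X =>
      {ρ ∈ pairings X | (∀ x ∈ P, ρ x ∉ P) ∧ ∀ x ∈ P, ρ x = σ x}.ncard) hσ)
    rw [← Set.ncard_coe_finset]
    refine Set.ncard_le_ncard ?_ (Set.toFinite _)
    intro ρ hρ
    simp only [Finset.coe_filter, Set.mem_ofPred_eq] at hρ
    have hρF := (Finset.mem_filter.1 hρ.1).2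
    refine ⟨hρF.1, hρF.2.1, fun x hx => ?_⟩
    have := congrFun hρ.2 x
    simpa [res, hx] using this
  have h2 : (F.image res).card ≤
      (Q.card.descFactorial t * R.card.descFactorial (P.card - t)) * (P.powersetCard t).card := by
    refine Finset.card_le_mul_card_image_of_maps_to (f := S) ?_ _ ?_
    · intro f hf
      obtain ⟨σ, hσ, rfl⟩ := Finset.mem_image.1 hf
      have hσF := (Finset.mem_filter.1 hσ).2
      refine Finset.mem_powersetCard.2 ⟨Finset.filter_subset _ _, ?_⟩
      rw [← hσF.2.2, ← Set.ncard_coe_finset]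
      congr 1
      ext x
      simp only [Finset.coe_filter, Set.mem_ofPred_eq, Finset.mem_coe, S, res]
      refine and_congr_right fun hx => ?_
      rw [if_pos hx]
    · intro U hU
      obtain ⟨hUP, hUc⟩ := Finset.mem_powersetCard.1 hU
      have hc : Fintype.card ((U ↪ Q) × ((P \ U : Finset X) ↪ R)) =
          Q.card.descFactorial t * R.card.descFactorial (P.card - t) := by
        rw [Fintype.card_prod, Fintype.card_embedding_eq, Fintype.card_embedding_eq,
          Fintype.card_coe, Fintype.card_coe, Fintype.card_coe, Fintype.card_coe,
          Finset.card_sdiff_of_subset hUP, hUc]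
      rw [← hc, ← Fintype.card_coe]
      have key : ∀ f ∈ (F.image res).filter (fun f => S f = U),
          Set.InjOn f P ∧ (∀ x ∈ U, f x ∈ Q) ∧ (∀ x ∈ P \ U, f x ∈ R) ∧ ∀ x ∉ P, f x = x := by
        intro f hf
        obtain ⟨hf1, rfl⟩ := Finset.mem_filter.1 hf
        obtain ⟨σ, hσ, rfl⟩ := Finset.mem_image.1 hf1
        have hσF := (Finset.mem_filter.1 hσ).2
        refine ⟨?_, ?_, ?_, ?_⟩
        · intro x hx y hy hxy
          simp only [res, Finset.mem_coe.1 hx, Finset.mem_coe.1 hy, if_true] at hxy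
          exact σ.injective hxy
        · intro x hx
          exact (Finset.mem_filter.1 hx).2
        · intro x hx
          obtain ⟨hxP, hxS⟩ := Finset.mem_sdiff.1 hx
          rw [hR, Finset.mem_compl, Finset.mem_union, not_or]
          refine ⟨?_, fun h => hxS (Finset.mem_filter.2 ⟨hxP, h⟩)⟩
          simp only [res, hxP, if_true]
          exact hσF.2.1 x hxP
        · intro x hx
          simp [res, hx]
      refine Fintype.card_le_of_injective (fun f =>
        (⟨fun x => ⟨f.1 x, (key f.1 f.2).2.1 x x.2⟩, ?_⟩,
         ⟨fun x => ⟨f.1 x, (key f.1 f.2).2.2.1 x x.2⟩, ?_⟩)) ?_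
      · intro x y h
        exact Subtype.ext ((key f.1 f.2).1 (hUP x.2) (hUP y.2) (congrArg Subtype.val h))
      · intro x y h
        exact Subtype.ext ((key f.1 f.2).1 (Finset.mem_sdiff.1 x.2).1 (Finset.mem_sdiff.1 y.2).1
          (congrArg Subtype.val h))
      · intro f g h
        obtain ⟨ha, hb⟩ := Prod.mk.inj h
        refine Subtype.ext (funext fun x => ?_)
        by_cases hx : x ∈ P
        · by_cases hxU : x ∈ U
          · exact congrArg Subtype.val (DFunLike.congr_fun ha ⟨x, hxU⟩)
          · exact congrArg Subtype.val
              (DFunLike.congr_fun hb ⟨x, Finset.mem_sdiff.2 ⟨hx, hxU⟩⟩)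
        · rw [(key f.1 f.2).2.2.2 x hx, (key g.1 g.2).2.2.2 x hx]
  rw [Finset.card_powersetCard] at h2
  rw [hF]
  calc F.card * (2 ^ k * k.factorial)
      ≤ (M * (F.image res).card) * (2 ^ k * k.factorial) := Nat.mul_le_mul_right _ h1
    _ = (F.image res).card * (M * (2 ^ k * k.factorial)) := by ring
    _ ≤ ((Q.card.descFactorial t * R.card.descFactorial (P.card - t)) * P.card.choose t) *
          (2 * k).factorial := Nat.mul_le_mul h2 hMle
    _ = _ := by ring

/-- The `d`-regular graphs in which `A` is independent and has `t` edges to `B`. -/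
def typedGraphs {V : Type*} (d : ℕ) (A B : Finset V) (t : ℕ) : Set (SimpleGraph V) :=
  {G ∈ regSet V d | G.IsIndepSet (A : Set V) ∧
    ∑ v ∈ A, (G.neighborSet v ∩ (B : Set V)).ncard = t}

/-- Ordering the neighbours of each vertex, in `d!` ways per vertex, turns a simple `d`-regular
graph into a pairing of the half-edges `V × Fin d`. The pairing gives back first the graph and then
the orderings, so distinct choices yield distinct pairings. -/
lemma ncard_typedGraphs_mul_le {V : Type*} [Fintype V] (d : ℕ) (A B : Finset V) (t : ℕ) :
    (typedGraphs d A B t).ncard * d.factorial ^ Fintype.card V ≤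
      (typedPairings (A ×ˢ (Finset.univ : Finset (Fin d))) (B ×ˢ Finset.univ) t).ncard := by
  classical
  have hE : ∀ G ∈ regSet V d, ∀ v, Nonempty (Fin d ≃ G.neighborSet v) := by
    intro G hG v
    refine ⟨(Fintype.equivFinOfCardEq ?_).symm⟩
    rw [← Nat.card_eq_fintype_card, Nat.card_coe_set_eq]
    exact hG v
  have e : ∀ (G : {G // G ∈ regSet V d}) v, Fin d ≃ G.1.neighborSet v :=
    fun G v => (hE G.1 G.2 v).some
  -- the partner of the half-edge `(v, i)`
  let T : (G : {G // G ∈ regSet V d}) → (V → Equiv.Perm (Fin d)) → V × Fin d → V × Fin d :=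
    fun G π x =>
      ((e G x.1 (π x.1 x.2) : V),
        (π (e G x.1 (π x.1 x.2))).symm ((e G (e G x.1 (π x.1 x.2))).symm
          ⟨x.1, (e G x.1 (π x.1 x.2)).2.symm⟩))
  have hT : ∀ G π, Function.Involutive (T G π) := by
    intro G π x
    have h1 : (T G π (T G π x)).1 = x.1 := by simp [T]
    refine Prod.ext h1 ?_
    have h2 : ∀ (w : V) (hw : w = x.1) (hmem : (e G x.1 (π x.1 x.2) : V) ∈ G.1.neighborSet w),
        (π w).symm ((e G w).symm ⟨(e G x.1 (π x.1 x.2) : V), hmem⟩) = x.2 := by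
      rintro _ rfl _
      simp
    exact h2 _ h1 _
  have hadj : ∀ (G : {G // G ∈ regSet V d}) (π : V → Equiv.Perm (Fin d)) (x : V × Fin d),
      G.1.Adj x.1 (T G π x).1 := fun G π x => (e G x.1 (π x.1 x.2)).2
  have hsum : ∀ (G : {G // G ∈ regSet V d}) (π : V → Equiv.Perm (Fin d)) (v : V),
      {i : Fin d | (T G π (v, i)).1 ∈ B}.ncard =
      (G.1.neighborSet v ∩ (B : Set V)).ncard := by
    intro G π v
    rw [← Set.ncard_image_of_injective {i : Fin d | (T G π (v, i)).1 ∈ B}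
      (f := fun i => ((e G v (π v i) : G.1.neighborSet v) : V))
      (Subtype.val_injective.comp ((e G v).injective.comp (π v).injective))]
    congr 1
    ext w
    simp only [Set.mem_image, Set.mem_ofPred_eq, Set.mem_inter_iff, T]
    constructor
    · rintro ⟨i, hi, rfl⟩
      exact ⟨(e G v (π v i)).2, hi⟩
    · rintro ⟨hw, hB⟩
      exact ⟨(π v).symm ((e G v).symm ⟨w, hw⟩), by simpa using hB, by simp⟩
  let F : SimpleGraph V × (V → Equiv.Perm (Fin d)) → Equiv.Perm (V × Fin d) := fun y =>
    if h : y.1 ∈ regSet V d then (hT ⟨y.1, h⟩ y.2).toPerm else 1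
  have hcard : (typedGraphs d A B t).ncard * d.factorial ^ Fintype.card V =
      ((typedGraphs d A B t) ×ˢ (Set.univ : Set (V → Equiv.Perm (Fin d)))).ncard := by
    rw [Set.ncard_prod, Set.ncard_univ, Nat.card_eq_fintype_card, Fintype.card_pi]
    simp [Fintype.card_perm]
  rw [hcard]
  refine Set.ncard_le_ncard_of_injOn F ?_ ?_ (Set.toFinite _)
  · rintro ⟨G, π⟩ ⟨⟨hG, hA, ht⟩, -⟩
    have hFx : ∀ x, F (G, π) x = T ⟨G, hG⟩ π x := by
      intro x; simp only [F]; rw [dif_pos hG]; rfl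
    refine ⟨⟨fun x => ?_, fun x h => ?_⟩, ?_, ?_⟩
    · rw [hFx, hFx]; exact hT _ _ x
    · rw [hFx] at h
      have := hadj ⟨G, hG⟩ π x
      rw [h] at this
      exact this.ne rfl
    · intro x hx hx'
      rw [hFx] at hx'
      have h1 := (Finset.mem_product.1 hx).1
      have h2 := (Finset.mem_product.1 hx').1
      have := hadj ⟨G, hG⟩ π x
      exact hA h1 h2 this.ne this
    · rw [← ht]
      have : {x ∈ ((A ×ˢ (Finset.univ : Finset (Fin d)) : Finset (V × Fin d)) : Set (V × Fin d)) |
          F (G, π) x ∈ B ×ˢ (Finset.univ : Finset (Fin d))} =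
          ((A.sigma fun v => Finset.univ.filter fun i => (T ⟨G, hG⟩ π (v, i)).1 ∈ B).map
            (Equiv.sigmaEquivProd V (Fin d)).toEmbedding : Finset (V × Fin d)) := by
        ext ⟨v, i⟩
        simp only [Set.mem_ofPred_eq, Finset.mem_coe, Finset.mem_product, Finset.mem_univ,
          and_true, Finset.mem_map_equiv, Finset.mem_sigma, Finset.mem_filter, true_and, hFx]
        rfl
      rw [this, Set.ncard_coe_finset, Finset.card_map, Finset.card_sigma]
      refine Finset.sum_congr rfl fun v _ => ?_
      rw [← hsum ⟨G, hG⟩ π v, ← Set.ncard_coe_finset]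
      congr 1
      ext; simp
  · rintro ⟨G, π⟩ ⟨⟨hG, -, -⟩, -⟩ ⟨H, ρ⟩ ⟨⟨hH, -, -⟩, -⟩ h
    have hx : ∀ x, T ⟨G, hG⟩ π x = T ⟨H, hH⟩ ρ x := by
      intro x
      have := DFunLike.congr_fun h x
      simp only [F] at this
      rw [dif_pos hG, dif_pos hH] at this
      exact this
    have hnb : ∀ (K : {G // G ∈ regSet V d}) (σ : V → Equiv.Perm (Fin d)) v w,
        K.1.Adj v w ↔ ∃ i, (T K σ (v, i)).1 = w := by
      intro K σ v w
      constructor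
      · intro hvw
        exact ⟨(σ v).symm ((e K v).symm ⟨w, hvw⟩), by simp [T]⟩
      · rintro ⟨i, rfl⟩
        exact hadj K σ (v, i)
    have hGH : G = H := by
      ext v w
      rw [hnb ⟨G, hG⟩ π, hnb ⟨H, hH⟩ ρ]
      simp only [hx]
    subst hGH
    refine Prod.ext rfl (funext fun v => Equiv.ext fun i => ?_)
    have h1 := congrArg Prod.fst (hx (v, i))
    exact (e ⟨G, hG⟩ v).injective (Subtype.val_injective h1)

/-! ### Stirling's formula and the rate function -/

/-- The main term `x log x - x` of Stirling's formula. -/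
noncomputable def stirlingTerm (x : ℝ) : ℝ := x * Real.log x - x

lemma stirlingTerm_le_log_factorial (n : ℕ) : stirlingTerm n ≤ Real.log n.factorial := by
  induction n with
  | zero => simp [stirlingTerm]
  | succ n ih =>
    rw [Nat.factorial_succ, Nat.cast_mul, Real.log_mul (by positivity) (by positivity)]
    unfold stirlingTerm at *
    rcases Nat.eq_zero_or_pos n with rfl | hn
    · simp
    have hn' : (0 : ℝ) < n := by exact_mod_cast hn
    have h := Real.log_le_sub_one_of_pos (show (0 : ℝ) < (n + 1) / n by positivity)
    rw [Real.log_div (by positivity) (by positivity)] at h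
    have h2 : n * (Real.log (n + 1) - Real.log n) ≤ 1 := by
      calc _ ≤ n * (((n : ℝ) + 1) / n - 1) := by gcongr
        _ = 1 := by field_simp; ring
    push_cast
    linarith

lemma log_factorial_le_stirlingTerm (n : ℕ) :
    Real.log n.factorial ≤ stirlingTerm n + (2 * Real.log (n + 1) + 1) := by
  induction n with
  | zero => simp [stirlingTerm]
  | succ n ih =>
    rw [Nat.factorial_succ, Nat.cast_mul, Real.log_mul (by positivity) (by positivity)]
    unfold stirlingTerm at *
    rcases Nat.eq_zero_or_pos n with rfl | hn
    · simp; positivity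
    have hn' : (0 : ℝ) < n := by exact_mod_cast hn
    have h := Real.log_le_sub_one_of_pos (show (0 : ℝ) < n / (n + 1) by positivity)
    rw [Real.log_div (by positivity) (by positivity)] at h
    have h2 : n / (n + 1) ≤ n * (Real.log (n + 1) - Real.log n) := by
      calc (n : ℝ) / (n + 1) = n * (1 - n / (n + 1)) := by field_simp; ring
        _ ≤ _ := mul_le_mul_of_nonneg_left (by linarith) hn'.le
    have h' := Real.log_le_sub_one_of_pos (show (0 : ℝ) < (n + 1) / (n + 2) by positivity)
    rw [Real.log_div (by positivity) (by positivity)] at h'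
    -- The induction step loses at most `1 / (n + 1)`, while each `log (n + 1)` in the error term
    -- gains at least `1 / (n + 2)`. One is too little, two suffice; hence the coefficient `2`.
    have h3 : 1 - (n : ℝ) / (n + 1) + 2 * ((n + 1) / (n + 2) - 1) ≤ 0 := by
      have : 1 - (n : ℝ) / (n + 1) + 2 * ((n + 1) / (n + 2) - 1) =
          - n / ((n + 1) * (n + 2)) := by field_simp; ring
      rw [this, neg_div]
      have : (0 : ℝ) ≤ n / ((n + 1) * (n + 2)) := by positivity
      linarith
    have e : ((n : ℝ) + 1 + 1) = n + 2 := by ring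
    push_cast
    rw [e]
    linarith

lemma stirlingTerm_mul (m x : ℝ) :
    stirlingTerm (m * x) = m * x * Real.log m - m * h x - m * x := by
  have := Real.negMulLog_mul m x
  simp only [Real.negMulLog, stirlingTerm, h] at *
  linarith

/-- The left side is the main term of `log ((2x)! / (2 ^ x * x!))`, the logarithm of the number of
pairings of `2x` points. -/
lemma stirlingTerm_two_mul {x : ℝ} (hx : 0 ≤ x) :
    stirlingTerm (2 * x) - stirlingTerm x - x * Real.log 2 = stirlingTerm (2 * x) / 2 := by
  rcases hx.eq_or_lt with rfl | hx
  · simp [stirlingTerm]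
  · unfold stirlingTerm
    rw [Real.log_mul (by norm_num) hx.ne']
    ring

lemma stirlingTerm_sub_le {x y : ℝ} (hx : 0 < x) (hy : 0 < y) :
    stirlingTerm y - stirlingTerm x ≤ (y - x) * Real.log y := by
  have h := Real.log_le_sub_one_of_pos (show (0 : ℝ) < y / x by positivity)
  rw [Real.log_div hy.ne' hx.ne'] at h
  have h2 : x * (Real.log y - Real.log x) ≤ y - x := by
    calc _ ≤ x * (y / x - 1) := by gcongr
      _ = _ := by field_simp
  unfold stirlingTerm
  linarith

lemma rate_identity {d : ℕ} {n a b t k τ : ℝ} (hn : 0 < n) (hk : 2 * k = d * (n - 2 * a))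
    (hk0 : 0 ≤ k) (ht : τ * (d * b) = t) :
    stirlingTerm n - stirlingTerm a - stirlingTerm b - stirlingTerm (n - a - b)
      + stirlingTerm (d * a) + stirlingTerm (d * b) + stirlingTerm (d * (n - a - b))
      - stirlingTerm t - stirlingTerm (d * a - t) - stirlingTerm (d * b - t)
      - stirlingTerm (d * (n - a - b) - (d * a - t))
      + (stirlingTerm (2 * k) - stirlingTerm k - k * Real.log 2)
      = n * phiHat d (a / n) (b / n) τ + stirlingTerm (d * n) / 2 := by
  rw [stirlingTerm_two_mul hk0, hk]
  obtain ⟨α, rfl⟩ : ∃ α, a = n * α := ⟨a / n, by field_simp⟩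
  obtain ⟨β, rfl⟩ : ∃ β, b = n * β := ⟨b / n, by field_simp⟩
  subst ht
  rw [mul_div_cancel_left₀ _ hn.ne', mul_div_cancel_left₀ _ hn.ne']
  rw [show n - n * α - n * β = n * (1 - α - β) by ring,
    show (d : ℝ) * (n * α) - τ * (d * (n * β)) = (d * n) * (α - τ * β) by ring,
    show (d : ℝ) * (n * β) - τ * (d * (n * β)) = (d * n) * ((1 - τ) * β) by ring,
    show (d : ℝ) * (n * (1 - α - β)) - (d * n) * (α - τ * β) =
      (d * n) * (1 - 2 * α - (1 - τ) * β) by ring,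
    show (d : ℝ) * (n - 2 * (n * α)) = (d * n) * (1 - 2 * α) by ring,
    show τ * ((d : ℝ) * (n * β)) = (d * n) * (τ * β) by ring,
    show (d : ℝ) * (n * α) = (d * n) * α by ring,
    show (d : ℝ) * (n * β) = (d * n) * β by ring,
    show (d : ℝ) * (n * (1 - α - β)) = (d * n) * (1 - α - β) by ring]
  simp only [stirlingTerm_mul n, stirlingTerm_mul ((d : ℝ) * n)]
  have e1 : h (τ * β) = β * h τ + τ * h β := Real.negMulLog_mul _ _
  have e2 : h ((1 - τ) * β) = β * h (1 - τ) + (1 - τ) * h β := Real.negMulLog_mul _ _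
  rw [e1, e2]
  have e3 : stirlingTerm n = n * Real.log n - n := rfl
  have e4 : stirlingTerm ((d : ℝ) * n) = d * n * Real.log (d * n) - d * n := rfl
  rw [e3, e4]
  unfold phiHat
  ring

/-- Feasible parameters of a `d`-regular graph on `N` vertices with an independent set of size `a`
that sends `t` edges to a disjoint set of size `b`. -/
structure Feasible (d N a b t : ℕ) : Prop where
  le_left : t ≤ d * a
  le_right : t ≤ d * b
  rest : d * a - t ≤ d * (N - a - b)
  half : 2 * (d * a) ≤ d * N

lemma typedPairings_nonempty_bounds {X : Type*} [Fintype X] [DecidableEq X] {P Q : Finset X}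
    {t : ℕ} (h : (typedPairings P Q t).Nonempty) :
    t ≤ P.card ∧ t ≤ Q.card ∧ P.card - t ≤ (P ∪ Q)ᶜ.card ∧ 2 * P.card ≤ Fintype.card X := by
  obtain ⟨σ, ⟨h1, h2⟩, h3, h4⟩ := h
  have e : {x ∈ (P : Set X) | σ x ∈ Q} = (P.filter fun x => σ x ∈ Q : Finset X) := by
    ext; simp
  rw [e, Set.ncard_coe_finset] at h4
  have hP : t ≤ P.card := h4 ▸ Finset.card_filter_le _ _
  refine ⟨hP, ?_, ?_, ?_⟩
  · rw [← h4]
    exact Finset.card_le_card_of_injOn σ (fun x hx => (Finset.mem_filter.1 hx).2)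
      σ.injective.injOn
  · have h5 := Finset.card_filter_add_card_filter_not (s := P) (fun x => σ x ∈ Q)
    have h6 : (P.filter fun x => σ x ∉ Q).card ≤ (P ∪ Q)ᶜ.card := by
      refine Finset.card_le_card_of_injOn σ (fun x hx => ?_) σ.injective.injOn
      have := Finset.mem_filter.1 hx
      simp only [Finset.coe_compl, Set.mem_compl_iff, Finset.mem_coe, Finset.mem_union, not_or]
      exact ⟨h3 x this.1, this.2⟩
    omega
  · have : P.card ≤ Pᶜ.card := by
      refine Finset.card_le_card_of_injOn σ (fun x hx => ?_) σ.injective.injOn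
      simpa using h3 x hx
    rw [Finset.card_compl] at this
    have := Finset.card_le_univ P
    omega

lemma card_compl_union_product {V : Type*} [Fintype V] [DecidableEq V] (d : ℕ) {A B : Finset V}
    (hAB : Disjoint A B) :
    ((A ×ˢ (Finset.univ : Finset (Fin d))) ∪ (B ×ˢ (Finset.univ : Finset (Fin d))))ᶜ.card =
      d * (Fintype.card V - A.card - B.card) := by
  rw [← Finset.union_product, Finset.card_compl, Finset.card_product,
    Finset.card_union_of_disjoint hAB]
  simp only [Fintype.card_prod, Fintype.card_fin, Finset.card_univ]
  rw [← Nat.sub_mul, mul_comm, Nat.sub_sub]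

lemma typedGraphs_feasible {V : Type*} [Fintype V] {d t : ℕ} {A B : Finset V}
    (hAB : Disjoint A B) (h : (typedGraphs d A B t).Nonempty) :
    Feasible d (Fintype.card V) A.card B.card t := by
  classical
  have h1 := ncard_typedGraphs_mul_le d A B t
  have h2 : 0 < (typedGraphs d A B t).ncard := (Set.ncard_pos (Set.toFinite _)).2 h
  have h3 : 0 < (typedPairings (A ×ˢ (Finset.univ : Finset (Fin d))) (B ×ˢ Finset.univ) t).ncard :=
    lt_of_lt_of_le (by positivity) h1
  have h4 := typedPairings_nonempty_bounds ((Set.ncard_pos (Set.toFinite _)).1 h3)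
  rw [card_compl_union_product d hAB] at h4
  simp only [Finset.card_product, Finset.card_univ, Fintype.card_fin, Fintype.card_prod] at h4
  obtain ⟨h4, h5, h6, h7⟩ := h4
  exact ⟨by linarith, by linarith, by rwa [mul_comm A.card] at h6, by linarith⟩

/-- The graphs with some sets `A`, `B` of sizes `a`, `b` as in `typedGraphs`. -/
def sizedGraphs (N d a b t : ℕ) : Set (SimpleGraph (Fin N)) :=
  {G | ∃ A B : Finset (Fin N), Disjoint A B ∧ A.card = a ∧ B.card = b ∧ G ∈ typedGraphs d A B t}

lemma ncard_typedGraphs_mul_le' {N d : ℕ} {A B : Finset (Fin N)} (hAB : Disjoint A B) {t k : ℕ}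
    (hk : d * N = 2 * (d * A.card) + 2 * k) :
    (typedGraphs d A B t).ncard * (d.factorial ^ N * (2 ^ k * k.factorial)) ≤
      ((d * A.card).choose t * ((d * B.card).descFactorial t *
        (d * (N - A.card - B.card)).descFactorial (d * A.card - t))) * (2 * k).factorial := by
  classical
  have h1 := ncard_typedGraphs_mul_le d A B t
  rw [Fintype.card_fin] at h1
  have h2 := ncard_typedPairings_mul_le (A ×ˢ (Finset.univ : Finset (Fin d)))
    (B ×ˢ (Finset.univ : Finset (Fin d))) t (k := k)
    (by simp [Fintype.card_prod]; linarith)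
  rw [card_compl_union_product d hAB, Finset.card_product, Finset.card_product, Finset.card_univ,
    Fintype.card_fin, Fintype.card_fin, mul_comm A.card, mul_comm B.card] at h2
  calc _ = (typedGraphs d A B t).ncard * d.factorial ^ N * (2 ^ k * k.factorial) := by ring
    _ ≤ _ := Nat.mul_le_mul_right _ h1
    _ ≤ _ := h2

lemma ncard_sizedGraphs_mul_le {N d a b t k : ℕ} (hk : d * N = 2 * (d * a) + 2 * k) :
    (sizedGraphs N d a b t).ncard * (d.factorial ^ N * (2 ^ k * k.factorial)) ≤
      (N.choose a * (N - a).choose b) * (((d * a).choose t * ((d * b).descFactorial t *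
        (d * (N - a - b)).descFactorial (d * a - t))) * (2 * k).factorial) := by
  classical
  let I : Finset (Finset (Fin N) × Finset (Fin N)) :=
    ((Finset.univ.powersetCard a).sigma fun A => (Aᶜ).powersetCard b).map
      (Equiv.sigmaEquivProd _ _).toEmbedding
  have hI : I.card = N.choose a * (N - a).choose b := by
    rw [Finset.card_map, Finset.card_sigma, Finset.sum_congr rfl (g := fun _ => (N - a).choose b)]
    · simp
    · intro A hA
      rw [Finset.card_powersetCard, Finset.card_compl, (Finset.mem_powersetCard.1 hA).2,
        Fintype.card_fin]
  have hmem : ∀ x, x ∈ I ↔ x.1.card = a ∧ Disjoint x.1 x.2 ∧ x.2.card = b := by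
    rintro ⟨A, B⟩
    simp only [I, Finset.mem_map_equiv, Finset.mem_sigma, Finset.mem_powersetCard]
    simp [Finset.subset_univ, Finset.subset_compl_comm, Finset.subset_compl_iff_disjoint_right,
      Equiv.sigmaEquivProd]
  have hsub : sizedGraphs N d a b t ⊆ ⋃ x ∈ I, typedGraphs d x.1 x.2 t := by
    rintro G ⟨A, B, hAB, ha, hb, hG⟩
    simp only [Set.mem_iUnion]
    exact ⟨(A, B), (hmem _).2 ⟨ha, hAB, hb⟩, hG⟩
  have h1 : (sizedGraphs N d a b t).ncard ≤ ∑ x ∈ I, (typedGraphs d x.1 x.2 t).ncard :=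
    (Set.ncard_le_ncard hsub (Set.toFinite _)).trans (Finset.set_ncard_biUnion_le _ _)
  rw [← hI, ← smul_eq_mul (I.card)]
  refine (Nat.mul_le_mul_right _ h1).trans ?_
  rw [Finset.sum_mul]
  refine Finset.sum_le_card_nsmul _ _ _ fun x hx => ?_
  obtain ⟨rfl, hd, rfl⟩ := (hmem x).1 hx
  exact ncard_typedGraphs_mul_le' hd hk

lemma log_choose {n k : ℕ} (hk : k ≤ n) :
    Real.log (n.choose k) = Real.log n.factorial - Real.log k.factorial
      - Real.log (n - k).factorial := by
  rw [← Nat.choose_mul_factorial_mul_factorial hk]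
  have := Nat.choose_pos hk
  push_cast
  rw [Real.log_mul (by positivity) (by positivity), Real.log_mul (by positivity) (by positivity)]
  ring

lemma log_descFactorial {n k : ℕ} (hk : k ≤ n) :
    Real.log (n.descFactorial k) = Real.log n.factorial - Real.log (n - k).factorial := by
  rw [← Nat.factorial_mul_descFactorial hk]
  have := (Nat.descFactorial_pos).2 hk
  push_cast
  rw [Real.log_mul (by positivity) (by positivity)]
  ring

lemma log_factorial_le_of_le {d N n : ℕ} (hn : n ≤ d * N) :
    Real.log n.factorial ≤ stirlingTerm n + (2 * Real.log (d * N + 1) + 1) := by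
  have h1 := log_factorial_le_stirlingTerm n
  have h2 : Real.log ((n : ℝ) + 1) ≤ Real.log (d * N + 1) := by
    apply Real.log_le_log (by positivity)
    have : (n : ℝ) ≤ d * N := by exact_mod_cast hn
    linarith
  linarith

lemma log_ncard_sizedGraphs_le {N d a b t : ℕ} (hd : 0 < d) (hN : 0 < N) (heven : Even (N * d))
    (hab : a + b ≤ N) (hf : Feasible d N a b t) (hpos : 0 < (sizedGraphs N d a b t).ncard)
    {τ : ℝ} (hτ : τ * (d * b) = t) :
    Real.log (sizedGraphs N d a b t).ncard ≤ N * phiHat d (a / N) (b / N) τ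
      + stirlingTerm (d * N) / 2 - N * Real.log d.factorial
      + 5 * (2 * Real.log (d * N + 1) + 1) := by
  obtain ⟨ht1, ht2, ht3, ht4⟩ := hf
  obtain ⟨k, hk⟩ : ∃ k, d * N = 2 * (d * a) + 2 * k := by
    obtain ⟨j, hj⟩ := heven
    exact ⟨j - d * a, by rw [mul_comm] at hj; omega⟩
  have hmain := ncard_sizedGraphs_mul_le (b := b) (t := t) hk
  have hNd : N ≤ d * N := Nat.le_mul_of_pos_left _ hd
  have p1 := Nat.choose_pos (show a ≤ N by omega)
  have p2 := Nat.choose_pos (show b ≤ N - a by omega)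
  have p3 := Nat.choose_pos ht1
  have p4 := (Nat.descFactorial_pos).2 ht2
  have p5 := (Nat.descFactorial_pos).2 ht3
  have hlog := Real.log_le_log (by positivity) (Nat.cast_le (α := ℝ) |>.2 hmain)
  push_cast at hlog
  rw [Real.log_mul (by positivity) (by positivity), Real.log_mul (by positivity) (by positivity),
    Real.log_mul (by positivity) (by positivity), Real.log_pow, Real.log_pow,
    Real.log_mul (by positivity) (by positivity), Real.log_mul (by positivity) (by positivity),
    Real.log_mul (by positivity) (by positivity), Real.log_mul (by positivity) (by positivity),
    Real.log_mul (by positivity) (by positivity), log_choose (show a ≤ N by omega),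
    log_choose (show b ≤ N - a by omega), log_choose ht1, log_descFactorial ht2,
    log_descFactorial ht3] at hlog
  have hle1 : d * a ≤ d * N := by gcongr; omega
  have hle2 : d * b ≤ d * N := by gcongr; omega
  have hle3 : d * (N - a - b) ≤ d * N := by gcongr; omega
  have u1 := log_factorial_le_of_le (d := d) (N := N) hNd
  have u2 := log_factorial_le_of_le (d := d) (N := N) hle1
  have u3 := log_factorial_le_of_le (d := d) (N := N) hle2
  have u4 := log_factorial_le_of_le (d := d) (N := N) hle3
  have u5 := log_factorial_le_of_le (d := d) (N := N) (n := 2 * k) (by omega)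
  have l1 := stirlingTerm_le_log_factorial a
  have l2 := stirlingTerm_le_log_factorial b
  have l3 := stirlingTerm_le_log_factorial (N - a - b)
  have l4 := stirlingTerm_le_log_factorial t
  have l5 := stirlingTerm_le_log_factorial (d * a - t)
  have l6 := stirlingTerm_le_log_factorial (d * b - t)
  have l7 := stirlingTerm_le_log_factorial (d * (N - a - b) - (d * a - t))
  have l8 := stirlingTerm_le_log_factorial k
  have c1 : ((N - a - b : ℕ) : ℝ) = N - a - b := by
    rw [Nat.cast_sub (by omega), Nat.cast_sub (by omega)]
  have hkr : 2 * (k : ℝ) = d * (N - 2 * a) := by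
    have : (d * N : ℝ) = 2 * (d * a) + 2 * k := by exact_mod_cast hk
    linarith
  have hid := rate_identity (d := d) (n := N) (a := a) (b := b) (t := t) (k := k) (τ := τ)
    (by exact_mod_cast hN) hkr (by positivity) hτ
  rw [Nat.cast_sub ht3] at l7
  rw [Nat.cast_sub ht1] at l5 l7
  rw [Nat.cast_sub ht2] at l6
  push_cast at u2 u3 u4 u5 l5 l6 l7
  rw [c1] at l3 u4 l7
  linarith

/-- Lower bound for the number of `d`-regular graphs, up to polynomial factors. -/
lemma exists_le_log_ncard_regularGraphs {d : ℕ} (hd : 0 < d) {N₀ : ℕ}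
    (hne : ∀ N, N₀ ≤ N → Even (N * d) → 0 < (regularGraphs N d).ncard) :
    ∃ C : ℝ, ∃ N₁ : ℕ, 0 ≤ C ∧ N₀ ≤ N₁ ∧ 0 < N₁ ∧ ∀ N, N₁ ≤ N → Even (N * d) →
      stirlingTerm (d * N) / 2 - N * Real.log d.factorial - C * Real.log N - C ≤
        Real.log (regularGraphs N d).ncard := by
  set N₁ := N₀ + 8 * d + 2 with hN₁
  let D : ℕ → ℝ := fun N => stirlingTerm (d * N) / 2 - N * Real.log d.factorial
    - Real.log (regularGraphs N d).ncard
  set C : ℝ := d * (4 * d + 2) + |D N₁| + |D (N₁ + 1)| with hC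
  have hC0 : 0 ≤ C := by positivity
  refine ⟨C, N₁, hC0, by omega, by omega, ?_⟩
  have hbase : ∀ N, 0 < N → D N ≤ C → stirlingTerm (d * N) / 2 - N * Real.log d.factorial
      - C * Real.log N - C ≤ Real.log (regularGraphs N d).ncard := by
    intro N hN hD
    have : 0 ≤ C * Real.log N := mul_nonneg hC0 (Real.log_natCast_nonneg N)
    simp only [D] at hD
    linarith
  have key : ∀ m, Even ((N₁ + m) * d) →
      stirlingTerm (d * (N₁ + m : ℕ)) / 2 - (N₁ + m : ℕ) * Real.log d.factorial
        - C * Real.log (N₁ + m : ℕ) - C ≤ Real.log (regularGraphs (N₁ + m) d).ncard := by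
    intro m
    induction m using Nat.twoStepInduction with
    | zero =>
      intro _
      refine hbase _ (by omega) ?_
      have h0 : (0 : ℝ) ≤ d * (4 * d + 2) := by positivity
      have := le_abs_self (D N₁)
      have := abs_nonneg (D (N₁ + 1))
      rw [add_zero]
      linarith
    | one =>
      intro _
      refine hbase _ (by omega) ?_
      have h0 : (0 : ℝ) ≤ d * (4 * d + 2) := by positivity
      have := le_abs_self (D (N₁ + 1))
      have := abs_nonneg (D N₁)
      linarith
    | more m ih _ =>
      intro heven
      rw [← add_assoc] at heven ⊢
      set N := N₁ + m with hN
      have hev : Even (N * d) := by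
        rw [Nat.even_mul] at heven ⊢
        rcases heven with h | h
        · left; rw [Nat.even_add] at h; simpa using h
        · exact .inr h
      have hN8 : 8 * d + 2 ≤ N := by omega
      have ih := ih hev
      have hp1 := hne N (by omega) hev
      have hp2 := hne (N + 2) (by omega) heven
      have hcount := card_regularGraphs_mul_pow_le N d
      have hsub : ((d * N - d * (4 * d) : ℕ) : ℝ) = d * ((N : ℝ) - 4 * d) := by
        rw [Nat.cast_sub (by gcongr; omega)]; push_cast; ring
      have hN8' : (8 * d + 2 : ℝ) ≤ N := by exact_mod_cast hN8
      have hd' : (1 : ℝ) ≤ d := by exact_mod_cast hd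
      have hpos : (0 : ℝ) < (N : ℝ) - 4 * d := by linarith
      have hNpos : (0 : ℝ) < N := by linarith
      have hcount' : ((regularGraphs N d).ncard : ℝ) * (d * ((N : ℝ) - 4 * d)) ^ d ≤
          (d.factorial * d.factorial) * (regularGraphs (N + 2) d).ncard := by
        rw [← hsub]; exact_mod_cast hcount
      have hlog := Real.log_le_log (by positivity) hcount'
      rw [Real.log_mul (by positivity) (by positivity), Real.log_pow,
        Real.log_mul (by positivity) (by positivity), Real.log_mul (by positivity) (by positivity),
        Real.log_mul (by positivity) (by positivity)] at hlog
      have hs := stirlingTerm_sub_le (x := d * (N : ℝ)) (y := d * ((N : ℝ) + 2))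
        (by positivity) (by positivity)
      rw [Real.log_mul (by positivity) (by positivity)] at hs
      have h1 := Real.log_le_sub_one_of_pos
        (show (0 : ℝ) < ((N : ℝ) + 2) / (N - 4 * d) by positivity)
      rw [Real.log_div (by positivity) (by positivity)] at h1
      have h1' : ((N : ℝ) + 2) / (N - 4 * d) - 1 ≤ (4 * d + 2) * (2 / (N + 2)) := by
        rw [show ((N : ℝ) + 2) / (N - 4 * d) - 1 = (4 * d + 2) * (1 / (N - 4 * d)) by
          field_simp; ring]
        gcongr ?_ * ?_
        rw [div_le_div_iff₀ hpos (by positivity)]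
        linarith
      have h2 := Real.log_le_sub_one_of_pos (show (0 : ℝ) < (N : ℝ) / (N + 2) by positivity)
      rw [Real.log_div (by positivity) (by positivity)] at h2
      have h2' : 2 / ((N : ℝ) + 2) ≤ Real.log (N + 2) - Real.log N := by
        have : (N : ℝ) / (N + 2) - 1 = - (2 / (N + 2)) := by field_simp; ring
        linarith
      have h3 : d * (4 * d + 2) * (2 / ((N : ℝ) + 2)) ≤
          C * (Real.log (N + 2) - Real.log N) := by
        have : (d * (4 * d + 2) : ℝ) ≤ C := by
          rw [hC]
          have := abs_nonneg (D N₁)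
          have := abs_nonneg (D (N₁ + 1))
          linarith
        gcongr
      have h4 : d * (Real.log ((N : ℝ) + 2) - Real.log (N - 4 * d)) ≤
          d * (4 * d + 2) * (2 / ((N : ℝ) + 2)) := by
        rw [mul_assoc]
        gcongr
        linarith
      push_cast
      nlinarith [hs, h3, h4, hlog, ih]
  intro N hN heven
  obtain ⟨m, rfl⟩ := Nat.exists_eq_add_of_le hN
  exact key m heven

lemma regularProb_le_one (N d : ℕ) (P : SimpleGraph (Fin N) → Prop) : regularProb N d P ≤ 1 := by
  refine div_le_one_of_le₀ ?_ (by positivity)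
  exact_mod_cast Set.ncard_le_ncard (Set.sep_subset _ _) (Set.toFinite _)

lemma regularProb_add_le {N d : ℕ} {P Q Z : SimpleGraph (Fin N) → Prop}
    (h : ∀ G ∈ regularGraphs N d, P G → Q G → Z G) :
    regularProb N d P + regularProb N d Q ≤ 1 + regularProb N d Z := by
  rcases Nat.eq_zero_or_pos (regularGraphs N d).ncard with h0 | hpos
  · simp [regularProb, h0]
  have hpos' : (0 : ℝ) < (regularGraphs N d).ncard := by exact_mod_cast hpos
  unfold regularProb
  rw [← add_div, ← div_self hpos'.ne', ← add_div]
  refine div_le_div_of_nonneg_right ?_ hpos'.le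
  have h1 := Set.ncard_inter_add_ncard_union {G ∈ regularGraphs N d | P G}
    {G ∈ regularGraphs N d | Q G} (Set.toFinite _) (Set.toFinite _)
  have h2 : ({G ∈ regularGraphs N d | P G} ∪ {G ∈ regularGraphs N d | Q G}).ncard ≤
      (regularGraphs N d).ncard := by
    refine Set.ncard_le_ncard ?_ (Set.toFinite _)
    rintro G (hG | hG) <;> exact hG.1
  have h3 : ({G ∈ regularGraphs N d | P G} ∩ {G ∈ regularGraphs N d | Q G}).ncard ≤
      {G ∈ regularGraphs N d | Z G}.ncard :=
    Set.ncard_le_ncard (fun G hG => ⟨hG.1.1, h G hG.1.1 hG.1.2 hG.2.2⟩) (Set.toFinite _)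
  exact_mod_cast (by omega :
    {G ∈ regularGraphs N d | P G}.ncard + {G ∈ regularGraphs N d | Q G}.ncard ≤
      (regularGraphs N d).ncard + {G ∈ regularGraphs N d | Z G}.ncard)

lemma AAS.of_imp {d : ℕ} {P Q Z : (N : ℕ) → SimpleGraph (Fin N) → Prop} (hP : AAS d P)
    (hQ : AAS d Q)
    (h : ∀ᶠ N in atTop, ∀ G ∈ regularGraphs N d, P N G → Q N G → Z N G) : AAS d Z := by
  have hlim : Tendsto (fun N => regularProb N d (P N) + regularProb N d (Q N) - 1)
      (atTop ⊓ 𝓟 {N : ℕ | Even (N * d)}) (𝓝 1) := by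
    have := (Tendsto.add hP hQ).sub_const 1
    simpa using this
  refine tendsto_of_tendsto_of_tendsto_of_le_of_le' hlim tendsto_const_nhds ?_
    (Eventually.of_forall fun N => regularProb_le_one N d _)
  filter_upwards [h.filter_mono inf_le_left] with N hN
  linarith [regularProb_add_le hN]

lemma AAS.eventually_exists {d : ℕ} {P : (N : ℕ) → SimpleGraph (Fin N) → Prop} (hP : AAS d P) :
    ∀ᶠ N in atTop, Even (N * d) → ∃ G ∈ regularGraphs N d, P N G := by
  have h := hP.eventually (lt_mem_nhds (zero_lt_one' ℝ))
  rw [eventually_inf_principal] at h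
  filter_upwards [h] with N hN heven
  have h1 := hN heven
  by_contra hcon
  push Not at hcon
  have : {G ∈ regularGraphs N d | P N G} = ∅ := by
    ext G; simpa using hcon G
  simp [regularProb, this] at h1

/-- Every pair of a set `B` and an independent set `A` has rate at least `-δ`. -/
def RateBound (d : ℕ) (δ : ℝ) (N : ℕ) (G : SimpleGraph (Fin N)) : Prop :=
  ∀ A B : Finset (Fin N), Disjoint A B → G.IsIndepSet (A : Set (Fin N)) → ∀ τ : ℝ,
    τ * (d * B.card) = (∑ v ∈ A, (G.neighborSet v ∩ (B : Set (Fin N))).ncard : ℕ) →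
      -δ ≤ phiHat d (A.card / N) (B.card / N) τ

lemma tendsto_exp_neg_mul_add_log {d : ℕ} (hd : 0 < d) {δ : ℝ} (hδ : 0 < δ) (C : ℝ) :
    Tendsto (fun N : ℕ => Real.exp (-(N * δ) + C * Real.log (d * N + 1) + C)) atTop (𝓝 0) := by
  refine Real.tendsto_exp_atBot.comp ?_
  have hd' : (0 : ℝ) < d := by exact_mod_cast hd
  have hx : Tendsto (fun N : ℕ => (d : ℝ) * N + 1) atTop atTop :=
    tendsto_atTop_add_const_right _ _
      (Tendsto.const_mul_atTop hd' tendsto_natCast_atTop_atTop)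
  have hε : 0 < δ / (2 * d * (|C| + 1)) := by positivity
  have hlog := hx.eventually (Real.isLittleO_log_id_atTop.def hε)
  have hlin : Tendsto (fun N : ℕ => -((δ / 2) * N) + (δ / (2 * d) + C)) atTop atBot := by
    refine tendsto_atBot_add_const_right _ _ ?_
    exact tendsto_neg_atTop_atBot.comp
      (Tendsto.const_mul_atTop (by positivity) tendsto_natCast_atTop_atTop)
  refine tendsto_atBot_mono' _ ?_ hlin
  filter_upwards [hlog] with N hN
  simp only [id, Real.norm_eq_abs] at hN
  have hx0 : (0 : ℝ) ≤ d * N := by positivity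
  have hl0 : 0 ≤ Real.log (d * N + 1) := Real.log_nonneg (by linarith)
  rw [abs_of_nonneg hl0, abs_of_nonneg (show (0 : ℝ) ≤ d * N + 1 by linarith)] at hN
  have h1 : C * Real.log (d * N + 1) ≤ (|C| + 1) * (δ / (2 * d * (|C| + 1)) * (d * N + 1)) := by
    calc C * Real.log (d * N + 1) ≤ (|C| + 1) * Real.log (d * N + 1) := by
          gcongr; linarith [le_abs_self C]
      _ ≤ _ := by gcongr
  have h2 : (|C| + 1) * (δ / (2 * d * (|C| + 1)) * (d * N + 1)) =
      (δ / 2) * N + δ / (2 * d) := by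
    have : |C| + 1 ≠ 0 := by positivity
    field_simp
  linarith

/-- The first moment bound. -/
lemma aas_rateBound {d : ℕ} (hd : 0 < d) {N₀ : ℕ}
    (hne : ∀ N, N₀ ≤ N → Even (N * d) → 0 < (regularGraphs N d).ncard) {δ : ℝ} (hδ : 0 < δ) :
    AAS d (RateBound d δ) := by
  classical
  obtain ⟨C, N₁, hC, hN₀, hN₁, hlow⟩ := exists_le_log_ncard_regularGraphs hd hne
  set C' : ℝ := C + 13 with hC'
  have hlim : Tendsto (fun N : ℕ => 1 - Real.exp (-(N * δ) + C' * Real.log (d * N + 1) + C'))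
      (atTop ⊓ 𝓟 {N : ℕ | Even (N * d)}) (𝓝 1) := by
    have := ((tendsto_exp_neg_mul_add_log hd hδ C').const_sub 1).mono_left
      (inf_le_left (b := 𝓟 {N : ℕ | Even (N * d)}))
    simpa using this
  refine tendsto_of_tendsto_of_tendsto_of_le_of_le' hlim tendsto_const_nhds ?_
    (Eventually.of_forall fun N => regularProb_le_one N d _)
  rw [eventually_inf_principal]
  filter_upwards [eventually_ge_atTop N₁] with N hN heven
  have heven : Even (N * d) := heven
  have hNpos : 0 < N := by omega
  have hR := hne N (by omega) heven
  have hR' : (0 : ℝ) < (regularGraphs N d).ncard := by exact_mod_cast hR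
  let I : Finset (ℕ × ℕ × ℕ) :=
    (Finset.range (N + 1) ×ˢ Finset.range (N + 1) ×ˢ Finset.range (d * N + 1)).filter fun x =>
      x.1 + x.2.1 ≤ N ∧ Feasible d N x.1 x.2.1 x.2.2 ∧
        ∃ τ : ℝ, τ * (d * x.2.1) = x.2.2 ∧ phiHat d (x.1 / N) (x.2.1 / N) τ < -δ
  set E : ℝ := -(N * δ) + (C + 10) * Real.log (d * N + 1) + (C + 5) with hE
  have hlogN : Real.log N ≤ Real.log (d * N + 1) := by
    apply Real.log_le_log (by exact_mod_cast hNpos)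
    have : (1 : ℝ) ≤ d := by exact_mod_cast hd
    nlinarith [(Nat.cast_nonneg N : (0 : ℝ) ≤ N)]
  have hsize : ∀ x ∈ I, ((sizedGraphs N d x.1 x.2.1 x.2.2).ncard : ℝ) ≤
      (regularGraphs N d).ncard * Real.exp E := by
    intro x hx
    obtain ⟨-, hab, hf, τ, hτ, hφ⟩ := Finset.mem_filter.1 hx
    rcases Nat.eq_zero_or_pos (sizedGraphs N d x.1 x.2.1 x.2.2).ncard with h0 | hpos
    · rw [h0]; simp; positivity
    have h1 := log_ncard_sizedGraphs_le hd hNpos heven hab hf hpos hτ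
    have h2 := hlow N hN heven
    have h3 : Real.log (sizedGraphs N d x.1 x.2.1 x.2.2).ncard ≤
        Real.log (regularGraphs N d).ncard + E := by
      have h4 : (N : ℝ) * phiHat d (x.1 / N) (x.2.1 / N) τ ≤ N * (-δ) := by gcongr
      have h5 : C * Real.log N ≤ C * Real.log (d * N + 1) := by gcongr
      rw [hE]
      linarith
    have hpos' : (0 : ℝ) < (sizedGraphs N d x.1 x.2.1 x.2.2).ncard := by exact_mod_cast hpos
    rw [← Real.exp_log hpos']
    nth_rewrite 1 [← Real.exp_log hR']
    rw [← Real.exp_add]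
    exact Real.exp_le_exp.2 h3
  have hsub : regularGraphs N d ⊆ {G ∈ regularGraphs N d | RateBound d δ N G} ∪
      ⋃ x ∈ I, sizedGraphs N d x.1 x.2.1 x.2.2 := by
    intro G hG
    by_cases hb : RateBound d δ N G
    · exact .inl ⟨hG, hb⟩
    right
    unfold RateBound at hb
    push Not at hb
    obtain ⟨A, B, hAB, hA, τ, hτ, hφ⟩ := hb
    rw [regularGraphs_eq_regSet] at hG
    have hmem : G ∈ typedGraphs d A B (∑ v ∈ A, (G.neighborSet v ∩ (B : Set (Fin N))).ncard) :=
      ⟨hG, hA, rfl⟩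
    have hf := typedGraphs_feasible hAB ⟨G, hmem⟩
    rw [Fintype.card_fin] at hf
    have hab : A.card + B.card ≤ N := by
      rw [← Finset.card_union_of_disjoint hAB]
      simpa using Finset.card_le_univ (A ∪ B)
    simp only [Set.mem_iUnion]
    refine ⟨(A.card, B.card, _), ?_, A, B, hAB, rfl, rfl, hmem⟩
    refine Finset.mem_filter.2 ⟨?_, hab, hf, τ, hτ, hφ⟩
    simp only [Finset.mem_product, Finset.mem_range]
    refine ⟨by omega, by omega, ?_⟩
    have hAN : d * A.card ≤ d * N := by gcongr; omega
    exact Nat.lt_succ_of_le (hf.le_left.trans hAN)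
  have hI : (I.card : ℝ) ≤ Real.exp (3 * Real.log (d * N + 1)) := by
    have h1 : I.card ≤ (N + 1) * ((N + 1) * (d * N + 1)) := by
      refine (Finset.card_filter_le _ _).trans (le_of_eq ?_)
      simp
    have h2 : N + 1 ≤ d * N + 1 := by
      have := Nat.le_mul_of_pos_left N hd
      omega
    have h3 : I.card ≤ (d * N + 1) ^ 3 := by
      calc _ ≤ _ := h1
        _ ≤ (d * N + 1) * ((d * N + 1) * (d * N + 1)) := by gcongr
        _ = _ := by ring
    have h4 : Real.exp (3 * Real.log (d * N + 1)) = ((d : ℝ) * N + 1) ^ 3 := by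
      rw [mul_comm, Real.exp_mul, Real.exp_log (by positivity)]
      norm_cast
    rw [h4]
    exact_mod_cast h3
  have hcount : ((regularGraphs N d).ncard : ℝ) ≤
      ({G ∈ regularGraphs N d | RateBound d δ N G}.ncard : ℝ) +
        I.card * ((regularGraphs N d).ncard * Real.exp E) := by
    have h1 := (Set.ncard_le_ncard hsub (Set.toFinite _)).trans (Set.ncard_union_le _ _)
    have h2 := h1.trans (Nat.add_le_add_left (Finset.set_ncard_biUnion_le I
      fun x => sizedGraphs N d x.1 x.2.1 x.2.2) _)
    have h3 : ((regularGraphs N d).ncard : ℝ) ≤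
        ({G ∈ regularGraphs N d | RateBound d δ N G}.ncard : ℝ) +
          ∑ x ∈ I, ((sizedGraphs N d x.1 x.2.1 x.2.2).ncard : ℝ) := by exact_mod_cast h2
    have h4 := Finset.sum_le_card_nsmul I _ _ hsize
    rw [nsmul_eq_mul] at h4
    linarith
  have hfin : (I.card : ℝ) * Real.exp E ≤
      Real.exp (-(N * δ) + C' * Real.log (d * N + 1) + C') := by
    calc _ ≤ Real.exp (3 * Real.log (d * N + 1)) * Real.exp E := by gcongr
      _ ≤ _ := by
        rw [← Real.exp_add]
        refine Real.exp_le_exp.2 ?_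
        rw [hE, hC']
        linarith
  unfold regularProb
  rw [le_div_iff₀ hR']
  nlinarith [mul_le_mul_of_nonneg_left hfin hR'.le]

lemma SimpleCondition.bestCondition {d k dhat : ℕ} (hdhat : dhat < d) {α : ℝ}
    (h : SimpleCondition d k dhat α) : BestCondition d k dhat α := by
  intro β τ hdom hβ _ _
  have hpos : (0 : ℝ) < (d : ℝ) - dhat := by
    have : (dhat : ℝ) < d := by exact_mod_cast hdhat
    linarith
  have hle : (τ * (d : ℝ) - dhat) * β ≤ (d - dhat) * β := by
    have : τ * (d : ℝ) ≤ d := mul_le_of_le_one_left (by positivity) hdom.2.2.2.1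
    gcongr
    · exact hdom.1
  unfold SimpleCondition at h
  refine lt_of_le_of_lt hle ?_
  have : ((((d : ℝ) - dhat) * β : ℝ) : EReal) < ((α - alphaDK d k : ℝ) : EReal) := by
    refine lt_of_le_of_lt ?_ h
    rw [EReal.coe_mul]
    exact mul_le_mul_of_nonneg_left hβ (by exact_mod_cast hpos.le)
  exact_mod_cast this

lemma continuous_phiHat (d : ℕ) :
    Continuous fun x : ℝ × ℝ × ℝ => phiHat d x.1 x.2.1 x.2.2 := by
  unfold phiHat h
  have := Real.continuous_negMulLog
  fun_prop

lemma phiHat_half_neg {d : ℕ} (hd : 3 ≤ d) (τ : ℝ) : phiHat d (1 / 2) 0 τ < 0 := by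
  have hh : 0 < h (1 / 2) := by
    have := Real.log_pos (show (1 : ℝ) < 2 by norm_num)
    simp only [h, Real.negMulLog]
    rw [one_div, Real.log_inv]
    linarith
  have hd' : (3 : ℝ) ≤ d := by exact_mod_cast hd
  have e : phiHat d (1 / 2) 0 τ = (2 - d) * h (1 / 2) := by
    unfold phiHat
    norm_num
    ring
  rw [e]
  exact mul_neg_of_neg_of_pos (by linarith) hh

/-- For `τ` above `α / (1 - α)`, the typical value, the rate decreases. -/
lemma phiHat_le_of_le {d : ℕ} {α β σ τ : ℝ} (hβ : 0 < β) (hσ : 0 < σ) (hστ : σ ≤ τ) (hτ : τ ≤ 1)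
    (h1 : τ * β ≤ α) (h2 : β ≤ 1 - 2 * α) (hα : α ≤ σ * (1 - α)) :
    phiHat d α β τ ≤ phiHat d α β σ := by
  let g : ℝ → ℝ := fun x => 2 * β * (h x + h (1 - x)) + 2 * h (α - x * β)
    + 2 * h (1 - 2 * α - (1 - x) * β)
  have hcont : ContinuousOn g (Set.Icc σ τ) := by
    have := Real.continuous_negMulLog
    simp only [g, h]
    fun_prop
  have hα0 : 0 < α := lt_of_lt_of_le (by nlinarith) h1
  have hder : ∀ x ∈ Set.Ioo σ τ, HasDerivAt g
      (2 * β * ((-Real.log x - 1) + (-Real.log (1 - x) - 1) * (-1))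
        + 2 * ((-Real.log (α - x * β) - 1) * (-β))
        + 2 * ((-Real.log (1 - 2 * α - (1 - x) * β) - 1) * β)) x := by
    intro x ⟨hx1, hx2⟩
    have p1 : 0 < x := hσ.trans hx1
    have p2 : 0 < 1 - x := by linarith
    have p3 : 0 < α - x * β := by nlinarith
    have p4 : 0 < 1 - 2 * α - (1 - x) * β := by nlinarith
    have d1 := Real.hasDerivAt_negMulLog p1.ne'
    have d2 := (Real.hasDerivAt_negMulLog p2.ne').comp x ((hasDerivAt_id x).const_sub 1)
    have d3 := (Real.hasDerivAt_negMulLog p3.ne').comp x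
      (((hasDerivAt_id x).mul_const β).const_sub α)
    have d4 := (Real.hasDerivAt_negMulLog p4.ne').comp x
      ((((hasDerivAt_id x).const_sub 1).mul_const β).const_sub (1 - 2 * α))
    have := (((d1.add d2).const_mul (2 * β)).add (d3.const_mul 2)).add (d4.const_mul 2)
    convert! this using 1
    ring
  have hanti : AntitoneOn g (Set.Icc σ τ) := by
    refine antitoneOn_of_deriv_nonpos (convex_Icc _ _) hcont ?_ ?_
    · rw [interior_Icc]
      exact fun x hx => (hder x hx).differentiableAt.differentiableWithinAt
    · rw [interior_Icc]
      intro x hx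
      rw [(hder x hx).deriv]
      obtain ⟨hx1, hx2⟩ := hx
      have p1 : 0 < x := hσ.trans hx1
      have p2 : 0 < 1 - x := by linarith
      have p3 : 0 < α - x * β := by nlinarith
      have p4 : 0 < 1 - 2 * α - (1 - x) * β := by nlinarith
      have hl := Real.log_le_log (mul_pos p2 p3)
        (show (1 - x) * (α - x * β) ≤ x * (1 - 2 * α - (1 - x) * β) by
          have : σ * (1 - α) ≤ x * (1 - α) := by
            apply mul_le_mul_of_nonneg_right hx1.le; linarith
          nlinarith)
      rw [Real.log_mul p2.ne' p3.ne', Real.log_mul p1.ne' p4.ne'] at hl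
      nlinarith
  have hg : g τ ≤ g σ := hanti ⟨le_rfl, hστ⟩ ⟨hστ, le_rfl⟩ hστ
  have hd : (0 : ℝ) ≤ (d : ℝ) / 2 := by positivity
  have e : ∀ x, phiHat d α β x = (d : ℝ) / 2 * (2 * h β + g x - h (1 - 2 * α))
      - ((d : ℝ) - 1) * (h α + h β + h (1 - α - β)) := by
    intro x
    simp only [phiHat, g]
    ring
  rw [e, e]
  gcongr

/-- The possible parameters of an independent set and a set of vertices that send at least a
proportion `σ` of their edges to it. -/
def region (σ : ℝ) : Set (ℝ × ℝ × ℝ) :=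
  {x | (0 ≤ x.2.1 ∧ σ ≤ x.2.2 ∧ x.2.2 ≤ 1) ∧ x.2.2 * x.2.1 ≤ x.1 ∧
    (1 - x.2.2) * x.2.1 ≤ 1 - 2 * x.1}

lemma isCompact_region {σ : ℝ} (hσ : 0 ≤ σ) : IsCompact (region σ) := by
  refine IsCompact.of_isClosed_subset
    (isCompact_Icc.prod (isCompact_Icc.prod isCompact_Icc) :
      IsCompact (Set.Icc (0 : ℝ) 1 ×ˢ Set.Icc (0 : ℝ) 1 ×ˢ Set.Icc (0 : ℝ) 1)) ?_ ?_
  · have h1 : IsClosed {x : ℝ × ℝ × ℝ | 0 ≤ x.2.1} := isClosed_le (by fun_prop) (by fun_prop)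
    have h2 : IsClosed {x : ℝ × ℝ × ℝ | σ ≤ x.2.2} := isClosed_le (by fun_prop) (by fun_prop)
    have h3 : IsClosed {x : ℝ × ℝ × ℝ | x.2.2 ≤ 1} := isClosed_le (by fun_prop) (by fun_prop)
    have h4 : IsClosed {x : ℝ × ℝ × ℝ | x.2.2 * x.2.1 ≤ x.1} :=
      isClosed_le (by fun_prop) (by fun_prop)
    have h5 : IsClosed {x : ℝ × ℝ × ℝ | (1 - x.2.2) * x.2.1 ≤ 1 - 2 * x.1} :=
      isClosed_le (by fun_prop) (by fun_prop)
    exact (h1.inter (h2.inter h3)).inter (h4.inter h5)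
  · rintro ⟨α, β, τ⟩ ⟨⟨h1, h2, h3⟩, h4, h5⟩
    dsimp only at h1 h2 h3 h4 h5
    have h6 : 0 ≤ τ * β := mul_nonneg (hσ.trans h2) h1
    have h7 : 0 ≤ (1 - τ) * β := mul_nonneg (by linarith) h1
    exact ⟨⟨by linarith, by linarith⟩, ⟨h1, by nlinarith⟩, ⟨by linarith, h3⟩⟩

lemma exists_margin {X : Type*} [TopologicalSpace X] {K : Set X} (hK : IsCompact K) {f g u : X → ℝ}
    (hf : Continuous f) (hg : Continuous g) (hu : Continuous u)
    (h : ∀ x ∈ K, f x ≤ 0 → g x ≤ 0 → 0 < u x) :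
    ∃ ε > 0, ∀ x ∈ K, f x < ε → g x < ε → ε ≤ u x := by
  obtain ⟨ε, hε, h'⟩ := hK.exists_forall_le' (f := fun x => max (f x) (max (g x) (u x)))
    (by fun_prop) (a := 0) (by
      intro x hx
      by_contra! hcon
      have h1 := (max_le_iff.1 hcon)
      have h2 := (max_le_iff.1 h1.2)
      exact absurd (h x hx h1.1 h2.1) (not_lt.2 h2.2))
  refine ⟨ε, hε, fun x hx h1 h2 => ?_⟩
  rcases le_max_iff.1 (h' x hx) with h3 | h3
  · linarith
  · rcases le_max_iff.1 h3 with h4 | h4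
    · linarith
    · exact h4

lemma le_one_sub_two_mul {d k dhat : ℕ} (hd : 3 ≤ d) (hk : d < 2 * k)
    (hdhat_k : dhat < k) {α : ℝ} (havg : (d : ℝ) * α ≤ ((dhat : ℝ) + 1) * (1 - α))
    (h0 : 0 ≤ phiHat d α 0 (tauPlus d dhat)) (hbest : BestCondition d k dhat α)
    (htop : betaMax d dhat α = ⊤)
    (hnot : ∀ β, 0 < β → InDomain α β (tauPlus d dhat) → 0 ≤ phiHat d α β (tauPlus d dhat))
    {β τ : ℝ} (hx : (α, β, τ) ∈ region (tauPlus d dhat)) : β ≤ 1 - 2 * α := by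
  obtain ⟨⟨h1, h2, h3⟩, h4, h5⟩ := hx
  dsimp only at h1 h2 h3 h4 h5
  by_contra! hcon
  have hd' : (3 : ℝ) ≤ d := by exact_mod_cast hd
  have hτ0 : 0 ≤ tauPlus d dhat := by unfold tauPlus; positivity
  have hτd : tauPlus d dhat * d = dhat + 1 := by unfold tauPlus; field_simp
  have hα2 : α ≤ 1 / 2 := by
    have : 0 ≤ (1 - τ) * β := mul_nonneg (by linarith) h1
    linarith
  have hα0 : 0 ≤ α := (mul_nonneg (hτ0.trans h2) h1).trans h4
  have hα : α < 1 / 2 := by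
    refine lt_of_le_of_ne hα2 ?_
    rintro rfl
    exact absurd h0 (not_le.2 (phiHat_half_neg hd _))
  have hdom : InDomain α (1 - 2 * α) (tauPlus d dhat) := by
    refine ⟨by linarith, le_rfl, hτ0, h2.trans h3, ?_⟩
    calc _ ≤ tauPlus d dhat * β := by gcongr
      _ ≤ τ * β := by gcongr
      _ ≤ α := h4
  have hc := hbest _ _ hdom (by rw [htop]; exact le_top) le_rfl (hnot _ (by linarith) hdom)
  rw [hτd] at hc
  unfold alphaDK at hc
  have hk0 : (0 : ℝ) < k := by
    have : 0 < k := by omega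
    exact_mod_cast this
  have hkd : (dhat : ℝ) + 1 ≤ k := by exact_mod_cast hdhat_k
  have hk2 : (d : ℝ) < 2 * k := by exact_mod_cast hk
  obtain ⟨r, hr⟩ : ∃ r : ℝ, (d : ℝ) = r * k := ⟨d / k, by field_simp⟩
  have hr2 : r < 2 := by
    rw [hr] at hk2
    exact lt_of_mul_lt_mul_right hk2 hk0.le
  have hc' : 1 - 2 * α < α - (1 - r / 2) := by
    have : (d : ℝ) / (2 * k) = r / 2 := by rw [hr]; field_simp
    rw [this] at hc
    linarith
  have hrα : r * α ≤ 1 - α := by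
    have : (r * α) * k ≤ (1 - α) * k := by
      calc (r * α) * k = d * α := by rw [hr]; ring
        _ ≤ ((dhat : ℝ) + 1) * (1 - α) := havg
        _ ≤ k * (1 - α) := by gcongr; linarith
        _ = _ := by ring
    exact le_of_mul_le_mul_right this hk0
  nlinarith

/-- The quantitative form of the conditions: either every pair with rate at least `-ε` is cheap to
repair, or this holds for `β ≤ s` and there are no such pairs with `β` near `s`. -/
lemma exists_repair_margin {d k dhat : ℕ} (hd : 3 ≤ d) (hk : d < 2 * k)
    (hdhat_k : dhat < k) {α : ℝ} (havg : (d : ℝ) * α ≤ ((dhat : ℝ) + 1) * (1 - α))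
    (h0 : 0 ≤ phiHat d α 0 (tauPlus d dhat)) (hbest : BestCondition d k dhat α) :
    ∃ ε > 0, ∃ p : ℝ → Prop,
      (∀ α' β τ, (α', β, τ) ∈ region (tauPlus d dhat) → |α' - α| < ε → p β →
        -ε < phiHat d α' β τ → (τ * d - dhat) * β + ε ≤ α' - alphaDK d k) ∧
      ((∀ β, p β) ∨ ∃ s > 0, (∀ β ≤ s, p β) ∧
        ∀ α' β τ, (α', β, τ) ∈ region (tauPlus d dhat) → |α' - α| < ε → |β - s| < ε →
          phiHat d α' β τ < -ε) := by
  have hd0 : (0 : ℝ) < d := by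
    have : 0 < d := by omega
    exact_mod_cast this
  have hσ : 0 < tauPlus d dhat := by unfold tauPlus; positivity
  have hφ := continuous_phiHat d
  set S : Set ℝ :=
    {β : ℝ | 0 < β ∧ InDomain α β (tauPlus d dhat) ∧ phiHat d α β (tauPlus d dhat) < 0} with hS
  have hbm : betaMax d dhat α = sInf ((fun β : ℝ => (β : EReal)) '' S) := rfl
  have hindom : ∀ β τ, (α, β, τ) ∈ region (tauPlus d dhat) → β ≤ 1 - 2 * α → InDomain α β τ :=
    fun β τ hx hβ => ⟨hx.1.1, hβ, hσ.le.trans hx.1.2.1, hx.1.2.2, hx.2.1⟩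
  rcases S.eq_empty_or_nonempty with hemp | hnon
  · have htop : betaMax d dhat α = ⊤ := by rw [hbm, hemp]; simp
    have hnot : ∀ β, 0 < β → InDomain α β (tauPlus d dhat) →
        0 ≤ phiHat d α β (tauPlus d dhat) := by
      intro β hβ hdom
      by_contra! hcon
      have : β ∈ S := ⟨hβ, hdom, hcon⟩
      rw [hemp] at this
      exact this
    obtain ⟨ε, hε, hm⟩ := exists_margin (isCompact_region hσ.le)
      (f := fun x => |x.1 - α|) (g := fun x => - phiHat d x.1 x.2.1 x.2.2)
      (u := fun x => x.1 - alphaDK d k - (x.2.2 * d - dhat) * x.2.1)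
      (by fun_prop) (by fun_prop) (by fun_prop) (by
        rintro ⟨α', β, τ⟩ hx h1 h2
        dsimp only at h1 h2 ⊢
        have hα' : α' = α := by
          have := abs_nonpos_iff.1 h1; linarith
        subst hα'
        have hβ := le_one_sub_two_mul hd hk hdhat_k havg h0 hbest htop hnot hx
        have := hbest β τ (hindom β τ hx hβ) (by rw [htop]; exact le_top) hx.1.2.1 (by linarith)
        linarith)
    refine ⟨ε, hε, fun _ => True, ?_, .inl fun _ => trivial⟩
    intro α' β τ hx h1 _ h2
    have := hm (α', β, τ) hx h1 (by dsimp only; linarith)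
    dsimp only at this
    linarith
  · set b := sInf S with hb
    have hbdd : BddBelow S := ⟨0, fun x hx => hx.1.le⟩
    obtain ⟨ε₁, hε₁, hm₁⟩ := exists_margin (isCompact_region hσ.le)
      (f := fun x => max |x.1 - α| (x.2.1 - b)) (g := fun x => - phiHat d x.1 x.2.1 x.2.2)
      (u := fun x => x.1 - alphaDK d k - (x.2.2 * d - dhat) * x.2.1)
      (by fun_prop) (by fun_prop) (by fun_prop) (by
        rintro ⟨α', β, τ⟩ hx h1 h2
        dsimp only at h1 h2 ⊢
        obtain ⟨h1, h3⟩ := max_le_iff.1 h1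
        have hα' : α' = α := by
          have := abs_nonpos_iff.1 h1; linarith
        subst hα'
        have hβ : ∀ s ∈ S, β ≤ s := fun s hs => by
          have := csInf_le hbdd hs
          linarith
        obtain ⟨s, hs⟩ := hnon
        have := hbest β τ (hindom β τ hx ((hβ s hs).trans hs.2.1.2.1))
          (by
            rw [hbm]
            refine le_sInf ?_
            rintro _ ⟨s, hs, rfl⟩
            exact EReal.coe_le_coe_iff.2 (hβ s hs)) hx.1.2.1 (by linarith)
        linarith)
    obtain ⟨s, hs, hsb⟩ := exists_lt_of_csInf_lt hnon (show b < b + ε₁ by linarith)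
    obtain ⟨ε₂, hε₂, hm₂⟩ := exists_margin (isCompact_region hσ.le)
      (f := fun x => |x.1 - α|) (g := fun x => |x.2.1 - s|)
      (u := fun x => - phiHat d x.1 x.2.1 x.2.2)
      (by fun_prop) (by fun_prop) (by fun_prop) (by
        rintro ⟨α', β, τ⟩ hx h1 h2
        dsimp only at h1 h2 ⊢
        have hα' : α' = α := by
          have := abs_nonpos_iff.1 h1; linarith
        have hβ' : β = s := by
          have := abs_nonpos_iff.1 h2; linarith
        subst hα'
        subst hβ'
        have hα : α' ≤ tauPlus d dhat * (1 - α') := by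
          unfold tauPlus
          rw [div_mul_eq_mul_div, le_div_iff₀ hd0]
          linarith
        have := phiHat_le_of_le (d := d) hs.1 hσ hx.1.2.1 hx.1.2.2 hx.2.1 hs.2.1.2.1 hα
        have := hs.2.2
        dsimp only at *
        linarith)
    have hlt1 : min ε₁ (ε₂ / 2) ≤ ε₁ := min_le_left _ _
    have hlt2 : min ε₁ (ε₂ / 2) ≤ ε₂ / 2 := min_le_right _ _
    refine ⟨min ε₁ (ε₂ / 2), by positivity, fun β => β ≤ s, ?_, .inr ⟨s, hs.1, fun _ h => h, ?_⟩⟩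
    · intro α' β τ hx h1 hβ h2
      have := hm₁ (α', β, τ) hx (max_lt (by dsimp only; linarith) (by dsimp only; linarith))
        (by dsimp only; linarith)
      dsimp only at this
      linarith
    · intro α' β τ hx h1 h2
      have := hm₂ (α', β, τ) hx (by dsimp only; linarith) (by dsimp only; linarith)
      dsimp only at this
      linarith

lemma IsThin.subset {V : Type*} [Finite V] {G : SimpleGraph V} {m : ℕ} {A A' : Finset V}
    (hA : IsThin G m A) (hsub : A' ⊆ A) : IsThin G m A' := by
  refine ⟨hA.1.mono (by exact_mod_cast hsub), fun v _ => ?_⟩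
  by_cases hv : v ∈ A
  · have : G.neighborSet v ∩ (A' : Set V) = ∅ := by
      ext w
      simp only [Set.mem_inter_iff, SimpleGraph.mem_neighborSet, Finset.mem_coe,
        Set.mem_empty_iff_false, iff_false, not_and]
      exact fun h hw => hA.1 (Finset.mem_coe.2 hv) (Finset.mem_coe.2 (hsub hw)) h.ne h
    simp [this]
  · exact (Set.ncard_le_ncard
      (Set.inter_subset_inter_right _ (by exact_mod_cast hsub)) (Set.toFinite _)).trans (hA.2 v hv)

/-- Deleting the excess neighbours of every vertex that has too many makes a set thin. -/
lemma exists_isThin {V : Type*} [Fintype V] {G : SimpleGraph V} {A B : Finset V} {m : ℕ}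
    (hA : G.IsIndepSet (A : Set V))
    (hB : ∀ v, v ∈ B ↔ v ∉ A ∧ m < (G.neighborSet v ∩ (A : Set V)).ncard) :
    ∃ A' : Finset V, IsThin G m A' ∧
      A.card + m * B.card ≤ A'.card + ∑ v ∈ B, (G.neighborSet v ∩ (A : Set V)).ncard := by
  classical
  have hex : ∀ v, ∃ D : Finset V, v ∈ B → (D : Set V) ⊆ G.neighborSet v ∩ (A : Set V) ∧
      D.card + m = (G.neighborSet v ∩ (A : Set V)).ncard := by
    intro v
    by_cases hv : v ∈ B
    · have hm := ((hB v).1 hv).2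
      obtain ⟨D, hD, hDc⟩ := Finset.exists_subset_card_eq
        (s := (G.neighborSet v ∩ (A : Set V)).toFinset)
        (n := (G.neighborSet v ∩ (A : Set V)).ncard - m)
        (by rw [← Set.ncard_eq_toFinset_card']; omega)
      exact ⟨D, fun _ => ⟨by intro x hx; simpa using hD hx, by omega⟩⟩
    · exact ⟨∅, fun h => absurd h hv⟩
  choose D hD using hex
  refine ⟨A \ B.biUnion D, ⟨hA.mono (by simp), fun v hv => ?_⟩, ?_⟩
  · by_cases hvA : v ∈ A
    · have : G.neighborSet v ∩ ((A \ B.biUnion D : Finset V) : Set V) = ∅ := by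
        ext w
        simp only [Set.mem_inter_iff, SimpleGraph.mem_neighborSet, Finset.mem_coe,
          Set.mem_empty_iff_false, iff_false, not_and]
        exact fun h hw => hA (Finset.mem_coe.2 hvA)
          (Finset.mem_coe.2 (Finset.sdiff_subset hw)) h.ne h
      rw [this, Set.ncard_empty]
      exact Nat.zero_le m
    by_cases hvB : v ∈ B
    · obtain ⟨h1, h2⟩ := hD v hvB
      have h3 : G.neighborSet v ∩ ((A \ B.biUnion D : Finset V) : Set V) ⊆
          (G.neighborSet v ∩ (A : Set V)) \ (D v : Set V) := by
        rintro w ⟨hw1, hw2⟩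
        obtain ⟨hw3, hw4⟩ := Finset.mem_sdiff.1 (Finset.mem_coe.1 hw2)
        exact ⟨⟨hw1, hw3⟩, fun hw5 => hw4 (Finset.mem_biUnion.2 ⟨v, hvB, hw5⟩)⟩
      have h4 := Set.ncard_le_ncard h3 (Set.toFinite _)
      have h5 := Set.ncard_sdiff_add_ncard_of_subset h1 (Set.toFinite _)
      rw [Set.ncard_coe_finset] at h5
      omega
    · have h1 : ¬ m < (G.neighborSet v ∩ (A : Set V)).ncard := fun h => hvB ((hB v).2 ⟨hvA, h⟩)
      have h2 : G.neighborSet v ∩ ((A \ B.biUnion D : Finset V) : Set V) ⊆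
          G.neighborSet v ∩ (A : Set V) :=
        Set.inter_subset_inter_right _ (by simp)
      have := Set.ncard_le_ncard h2 (Set.toFinite _)
      omega
  · have h1 : A.card ≤ (A \ B.biUnion D).card + (B.biUnion D).card := by
      have := Finset.le_card_sdiff (B.biUnion D) A
      omega
    have h2 : (B.biUnion D).card ≤ ∑ v ∈ B, (D v).card := Finset.card_biUnion_le
    have h3 : ∑ v ∈ B, (D v).card + m * B.card =
        ∑ v ∈ B, (G.neighborSet v ∩ (A : Set V)).ncard := by
      rw [mul_comm, ← smul_eq_mul, ← Finset.sum_const, ← Finset.sum_add_distrib]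
      exact Finset.sum_congr rfl fun v hv => (hD v hv).2
    omega

lemma sum_ncard_neighborSet_inter_comm {V : Type*} [Finite V] (G : SimpleGraph V)
    (A B : Finset V) :
    ∑ v ∈ A, (G.neighborSet v ∩ (B : Set V)).ncard =
      ∑ v ∈ B, (G.neighborSet v ∩ (A : Set V)).ncard := by
  classical
  have key : ∀ (v : V) (B : Finset V), (G.neighborSet v ∩ (B : Set V)).ncard =
      (B.filter fun w => G.Adj v w).card := by
    intro v B
    rw [← Set.ncard_coe_finset]
    congr 1
    ext w
    simp [and_comm]
  simp only [key]
  have := Finset.sum_card_bipartiteAbove_eq_sum_card_bipartiteBelow (s := A) (t := B) G.Adj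
  simpa only [Finset.bipartiteAbove, Finset.bipartiteBelow, G.adj_comm] using this

lemma exists_mem_region {N d dhat : ℕ} (hd : 0 < d) (hN : 0 < N) (hdhat : dhat < d)
    {G : SimpleGraph (Fin N)} (hG : G ∈ regSet (Fin N) d) {A B : Finset (Fin N)}
    (hA : G.IsIndepSet (A : Set (Fin N)))
    (hB : ∀ v ∈ B, v ∉ A ∧ dhat < (G.neighborSet v ∩ (A : Set (Fin N))).ncard) :
    ∃ τ : ℝ, τ * (d * B.card) = (∑ v ∈ A, (G.neighborSet v ∩ (B : Set (Fin N))).ncard : ℕ) ∧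
      ((A.card : ℝ) / N, (B.card : ℝ) / N, τ) ∈ region (tauPlus d dhat) := by
  have hAB : Disjoint A B := Finset.disjoint_right.2 fun v hv => (hB v hv).1
  set t := ∑ v ∈ A, (G.neighborSet v ∩ (B : Set (Fin N))).ncard with ht
  have hf := typedGraphs_feasible hAB ⟨G, hG, hA, ht.symm⟩
  rw [Fintype.card_fin] at hf
  obtain ⟨f1, f2, f3, f4⟩ := hf
  have hab : A.card + B.card ≤ N := by
    rw [← Finset.card_union_of_disjoint hAB]
    simpa using Finset.card_le_univ (A ∪ B)
  have hN' : (0 : ℝ) < N := by exact_mod_cast hN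
  have hd' : (0 : ℝ) < d := by exact_mod_cast hd
  have hτ1 : tauPlus d dhat ≤ 1 := by
    unfold tauPlus
    rw [div_le_one hd']
    exact_mod_cast hdhat
  have g4 : 2 * (A.card : ℝ) ≤ N := by
    have : 2 * ((d : ℝ) * A.card) ≤ d * N := by exact_mod_cast f4
    nlinarith
  rcases Nat.eq_zero_or_pos B.card with h0 | hpos
  · have ht0 : t = 0 := by rw [h0] at f2; omega
    refine ⟨tauPlus d dhat, by rw [h0, ht0]; simp, ⟨by rw [h0]; simp, le_rfl, hτ1⟩, ?_, ?_⟩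
    · rw [h0]; simp; positivity
    · rw [h0]
      simp only [CharP.cast_eq_zero, zero_div, mul_zero, sub_nonneg]
      rw [← mul_div_assoc, div_le_one hN']
      exact g4
  · have hb : (0 : ℝ) < B.card := by exact_mod_cast hpos
    have hlow : (dhat + 1) * B.card ≤ t := by
      rw [ht, sum_ncard_neighborSet_inter_comm, mul_comm, ← smul_eq_mul]
      exact Finset.card_nsmul_le_sum _ _ _ fun v hv => (hB v hv).2
    have hlow' : ((dhat : ℝ) + 1) * B.card ≤ t := by exact_mod_cast hlow
    have g1 : (t : ℝ) ≤ d * A.card := by exact_mod_cast f1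
    have g2 : (t : ℝ) ≤ d * B.card := by exact_mod_cast f2
    have g3 : (d : ℝ) * B.card - t ≤ d * (N - 2 * A.card) := by
      have h1 : d * A.card ≤ d * (N - A.card - B.card) + t := by omega
      have h2 : ((N - A.card - B.card : ℕ) : ℝ) = N - A.card - B.card := by
        rw [Nat.cast_sub (by omega), Nat.cast_sub (by omega)]
      have h3 : (d : ℝ) * A.card ≤ d * ((N - A.card - B.card : ℕ) : ℝ) + t := by
        exact_mod_cast h1
      rw [h2] at h3
      linarith
    have e : (t : ℝ) / (d * B.card) * (B.card / N) = t / (d * N) := by field_simp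
    refine ⟨t / (d * B.card), by field_simp, ⟨by positivity, ?_, ?_⟩, ?_, ?_⟩
    · dsimp only
      unfold tauPlus
      rw [div_le_div_iff₀ hd' (by positivity)]
      nlinarith
    · exact div_le_one_of_le₀ g2 (by positivity)
    · dsimp only
      rw [e, div_le_div_iff₀ (by positivity) hN']
      nlinarith
    · dsimp only
      rw [sub_mul, e, one_mul]
      have : (B.card : ℝ) / N - t / (d * N) = (d * B.card - t) / (d * N) := by field_simp
      rw [this, div_le_iff₀ (by positivity)]
      have : (1 - 2 * ((A.card : ℝ) / N)) * (d * N) = d * (N - 2 * A.card) := by field_simp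
      linarith

lemma phiHat_zero_nonneg {d dhat : ℕ} {α : ℝ} (hα : AASIndepDensity d α)
    (hrate : ∀ δ > 0, AAS d (RateBound d δ)) : 0 ≤ phiHat d α 0 (tauPlus d dhat) := by
  by_contra! hneg
  have hcont : Continuous fun x : ℝ => phiHat d x 0 (tauPlus d dhat) :=
    (continuous_phiHat d).comp (by fun_prop : Continuous fun x : ℝ => (x, (0 : ℝ), tauPlus d dhat))
  set δ := -phiHat d α 0 (tauPlus d dhat) / 2 with hδ
  have hδ0 : 0 < δ := by linarith
  obtain ⟨ε, hε, hball⟩ := Metric.eventually_nhds_iff.1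
    (hcont.continuousAt.eventually_lt (continuousAt_const (y := -δ)) (by linarith) :
      ∀ᶠ x in 𝓝 α, phiHat d x 0 (tauPlus d dhat) < -δ)
  have hboth : AAS d fun N G => (∃ A : Finset (Fin N), G.IsIndepSet (A : Set (Fin N)) ∧
      |(A.card : ℝ) / (N : ℝ) - α| < ε) ∧ RateBound d δ N G :=
    (hα ε hε).of_imp (hrate δ hδ0) (Eventually.of_forall fun N G _ h1 h2 => ⟨h1, h2⟩)
  obtain ⟨M, hM⟩ := eventually_atTop.1 hboth.eventually_exists
  obtain ⟨G, -, ⟨A, hA, hAα⟩, hr⟩ := hM (2 * M) (by omega) (by simp [mul_assoc])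
  have h1 := hr A ∅ (Finset.disjoint_empty_right _) hA (tauPlus d dhat) (by simp)
  have h2 := hball (y := (A.card : ℝ) / (2 * M : ℕ)) (by rwa [Real.dist_eq])
  simp only [Finset.card_empty, CharP.cast_eq_zero, zero_div] at h1
  linarith

lemma exists_isThin_card_eq {N d k dhat : ℕ} {α ε : ℝ} (hd : 0 < d) (hN : 0 < N)
    (hdhat : dhat < d) (hε : 1 < ε * N) (hαk : 0 ≤ alphaDK d k) {p : ℝ → Prop}
    (hp : ∀ α' β τ, (α', β, τ) ∈ region (tauPlus d dhat) → |α' - α| < ε → p β →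
        -ε < phiHat d α' β τ → (τ * d - dhat) * β + ε ≤ α' - alphaDK d k)
    (hp' : (∀ β, p β) ∨ ∃ s > 0, (∀ β ≤ s, p β) ∧
        ∀ α' β τ, (α', β, τ) ∈ region (tauPlus d dhat) → |α' - α| < ε → |β - s| < ε →
          phiHat d α' β τ < -ε)
    {G : SimpleGraph (Fin N)} (hG : G ∈ regSet (Fin N) d)
    (hA : ∃ A : Finset (Fin N), G.IsIndepSet (A : Set (Fin N)) ∧ |(A.card : ℝ) / N - α| < ε)
    (hr : RateBound d (ε / 2) N G) :
    ∃ A : Finset (Fin N), IsThin G dhat A ∧ A.card = ⌈alphaDK d k * (N : ℝ)⌉₊ := by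
  classical
  obtain ⟨A, hA, hAα⟩ := hA
  have hN' : (0 : ℝ) < N := by exact_mod_cast hN
  have hε0 : 0 < ε := by
    by_contra! h
    nlinarith
  let B : Finset (Fin N) := Finset.univ.filter fun v =>
    v ∉ A ∧ dhat < (G.neighborSet v ∩ (A : Set (Fin N))).ncard
  have hB : ∀ v, v ∈ B ↔ v ∉ A ∧ dhat < (G.neighborSet v ∩ (A : Set (Fin N))).ncard := by
    intro v; simp [B]
  have hsubset : ∀ B' ⊆ B, ∃ τ : ℝ,
      τ * (d * B'.card) = (∑ v ∈ A, (G.neighborSet v ∩ (B' : Set (Fin N))).ncard : ℕ) ∧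
      ((A.card : ℝ) / N, (B'.card : ℝ) / N, τ) ∈ region (tauPlus d dhat) ∧
      -ε < phiHat d (A.card / N) (B'.card / N) τ := by
    intro B' hB'
    have hB'' : ∀ v ∈ B', v ∉ A ∧ dhat < (G.neighborSet v ∩ (A : Set (Fin N))).ncard :=
      fun v hv => (hB v).1 (hB' hv)
    obtain ⟨τ, h1, h2⟩ := exists_mem_region hd hN hdhat hG hA hB''
    refine ⟨τ, h1, h2, ?_⟩
    have := hr A B' (Finset.disjoint_right.2 fun v hv => (hB'' v hv).1) hA τ h1
    linarith
  have hpB : p (B.card / N) := by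
    rcases hp' with h | ⟨s, hs, h1, h2⟩
    · exact h _
    refine h1 _ ?_
    rw [div_le_iff₀ hN']
    by_contra! hcon
    have hle : ⌊s * N⌋₊ ≤ B.card := by
      have := Nat.floor_le (show 0 ≤ s * N by positivity)
      exact_mod_cast this.trans hcon.le
    obtain ⟨B', hB', hcard⟩ := Finset.exists_subset_card_eq hle
    obtain ⟨τ, -, h3, h4⟩ := hsubset B' hB'
    have h5 := h2 _ _ _ h3 hAα (by
      have f1 := Nat.floor_le (show 0 ≤ s * N by positivity)
      have f2 := Nat.lt_floor_add_one (s * N)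
      rw [hcard, abs_lt]
      constructor
      · rw [lt_sub_iff_add_lt, lt_div_iff₀ hN']
        nlinarith
      · rw [sub_lt_iff_lt_add, div_lt_iff₀ hN']
        nlinarith)
    linarith
  obtain ⟨τ, hτ, hreg, hφ⟩ := hsubset B subset_rfl
  have hfin := hp _ _ _ hreg hAα hpB hφ
  obtain ⟨A', hthin, hcard⟩ := exists_isThin hA hB
  rw [← sum_ncard_neighborSet_inter_comm] at hcard
  set t := ∑ v ∈ A, (G.neighborSet v ∩ (B : Set (Fin N))).ncard
  have hcard' : (A.card : ℝ) + dhat * B.card ≤ A'.card + t := by exact_mod_cast hcard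
  have hfin' : (τ * d - dhat) * B.card + ε * N ≤ A.card - alphaDK d k * N := by
    have := mul_le_mul_of_nonneg_right hfin hN'.le
    have e1 : ((τ * d - dhat) * (B.card / N) + ε) * N = (τ * d - dhat) * B.card + ε * N := by
      field_simp
    have e2 : ((A.card : ℝ) / N - alphaDK d k) * N = A.card - alphaDK d k * N := by field_simp
    linarith
  have hceil : ⌈alphaDK d k * (N : ℝ)⌉₊ ≤ A'.card := by
    have h1 := Nat.ceil_lt_add_one (show 0 ≤ alphaDK d k * N by positivity)
    have h2 : (⌈alphaDK d k * (N : ℝ)⌉₊ : ℝ) ≤ A'.card := by nlinarith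
    exact_mod_cast h2
  obtain ⟨A'', hsub, hA''⟩ := Finset.exists_subset_card_eq hceil
  exact ⟨A'', hthin.subset hsub, hA''⟩

end ThinSets

theorem lemma4p4 (d : ℕ) (hd : 3 ≤ d) (α : ℝ) (hα : ThinSets.AASIndepDensity d α)
    (k dhat : ℕ) (hk : d < 2 * k) (hdhat_pos : 0 < dhat) (hdhat_d : dhat < d) (hdhat_k : dhat < k)
    (havg : (d : ℝ) * α ≤ ((dhat : ℝ) + 1) * (1 - α))
    (hcond : ThinSets.SimpleCondition d k dhat α ∨ ThinSets.BestCondition d k dhat α) :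
    ThinSets.AAS d fun N G =>
      ∃ A : Finset (Fin N), ThinSets.IsThin G dhat A ∧
        A.card = ⌈ThinSets.alphaDK d k * (N : ℝ)⌉₊ := by
  open ThinSets in
  have hd0 : 0 < d := by omega
  have hbest : BestCondition d k dhat α := hcond.elim (fun h => h.bestCondition hdhat_d) id
  obtain ⟨N₀, hN₀⟩ := eventually_atTop.1 (hα 1 one_pos).eventually_exists
  have hne : ∀ N, N₀ ≤ N → Even (N * d) → 0 < (regularGraphs N d).ncard := by
    intro N hN heven
    obtain ⟨G, hG, -⟩ := hN₀ N hN heven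
    exact (Set.ncard_pos (Set.toFinite _)).2 ⟨G, hG⟩
  have hrate : ∀ δ > 0, AAS d (RateBound d δ) := fun δ hδ => aas_rateBound hd0 hne hδ
  have h0 := phiHat_zero_nonneg (dhat := dhat) hα hrate
  obtain ⟨ε, hε, p, hp, hp'⟩ := exists_repair_margin hd hk hdhat_k havg h0 hbest
  have hαk : 0 ≤ alphaDK d k := by
    unfold alphaDK
    rw [sub_nonneg]
    refine div_le_one_of_le₀ ?_ (by positivity)
    exact_mod_cast hk.le
  have hlarge : ∀ c : ℝ, 0 < c → ∀ᶠ N : ℕ in atTop, 1 < c * N := fun c hc =>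
    (Tendsto.const_mul_atTop hc tendsto_natCast_atTop_atTop).eventually_gt_atTop 1
  refine (hα ε hε).of_imp (hrate (ε / 2) (by positivity)) ?_
  filter_upwards [hlarge ε hε, eventually_gt_atTop 0] with N hN hN0 G hG hA hr
  rw [regularGraphs_eq_regSet] at hG
  exact exists_isThin_card_eq hd0 hN0 hdhat_d hN hαk hp hp' hG hA hr
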